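/- Conventions. Let $K$ be a field, $m\ge 1$, $A=[a_{i,j}]\in K[X]^{m\times m}$ and $s\in\mathbb Z^m$. The degree $\deg(A)$ of a nonzero matrix is the maximum of the degrees of its entries, and the generic determinant bound is $\sigma(A)=\max_{\pi\in S_m}\sum_{i=1}^m\overline{\deg}(a_{i,\pi(i)})$, where $\overline{\deg}(0)=0$ and $\overline{\deg}(p)=\deg p$ for $p\ne0$. The $s$-degree of a row $p=[p_1,\dots,p_m]$ is $\max_j(\deg p_j+s_j)$, and the $s$-pivot index of a nonzero row $p$ is the largest $j$ at which this maximum is attained; $p_j$ is then the $s$-pivot entry. The $s$-leading matrix of $P$, whose rows have $s$-degrees $d_1,\dots,d_m$, has as entry $(i,j)$ the coefficient of degree $d_i-s_j$ of $P_{i,j}$; a nonsingular $P$ is $s$-reduced if its $s$-leading matrix is nonsingular. It is in $s$-Popov form if the $s$-pivot indices of its rows are strictly increasing, the pivot entries are monic, and in each column containing a pivot all other entries have degree less than the pivot entry. The $s$-Popov form of a nonsingular $A$ is the unique $s$-reduced matrix in $s$-Popov form whose rows generate the same $K[X]$-module as the rows of $A$. Proposition 3.2. Let $A\in K[X]^{m\times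 m}$ be nonsingular and let $s\in\mathbb Z^m$. With no field operation, one can build from $A$ and $s$ a nonsingular matrix $\tilde A\in K[X]^{\tilde m\times\tilde m}$ and a shift $u\in\mathbb Z^{\tilde m}$ such that $m\le\tilde m\le 3m$, $\deg(\tilde A)\le\lceil\sigma(A)/m\rceil$, and the $s$-Popov form of $A$ is the leading principal $m\times m$ submatrix of the $u$-Popov form of $\tilde A$. Here "with no field operation, one can build" means the following. There is a single computable function, independent of $K$, which from the degrees $\overline{\deg}(a_{i,j})$ and the shift $s$ computes $\tilde m$, $u$, and a straight-line program (whose operands are the constants $0,1,-1$, the coefficients of the entries of $A$, and the results of earlier steps, and whose steps are additions, subtractions, multiplications and divisions in $K$) with a designation of its operands as the coefficients of the entries of $\tilde A$; and this program has no step at all. -/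

import Mathlib

open Polynomial

noncomputable section

namespace PolyMat

/-! ### Shifted degrees, reduced forms, Popov forms -/

section Popov

variable {K : Type*} [Field K] {m n : ℕ}

/-- The `s`-degree `max_j (deg p_j + s_j)` of a row `p`; it is `⊥` exactly for the zero row
(when there is a column at all). -/
def shiftedDegree (s : Fin n → ℤ) (p : Fin n → K[X]) : WithBot ℤ :=
  Finset.univ.sup fun j => (p j).degree.map (fun d : ℕ => (d : ℤ)) + (s j : WithBot ℤ)

/-- The `s`-leading matrix: its entry `(i, j)` is the coefficient of degree `d_i - s_j` of `P i j`,
where `d_i` is the `s`-degree of row `i` (zero if that exponent is negative, and on zero rows). -/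
def leadingMatrix (s : Fin n → ℤ) (P : Matrix (Fin m) (Fin n) K[X]) : Matrix (Fin m) (Fin n) K :=
  Matrix.of fun i j =>
    let d : ℤ := (shiftedDegree s (P.row i)).unbotD 0
    if s j ≤ d then (P i j).coeff (d - s j).toNat else 0

/-- `P` is `s`-reduced: `P` and its `s`-leading matrix have full (row) rank. -/
def IsReduced (s : Fin n → ℤ) (P : Matrix (Fin m) (Fin n) K[X]) : Prop :=
  LinearIndependent K[X] P.row ∧ LinearIndependent K (leadingMatrix s P).row

/-- `j` is the `s`-pivot index of the nonzero row `p`: the largest index at which the `s`-degree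
of `p` is attained. -/
def IsPivotIndex (s : Fin n → ℤ) (p : Fin n → K[X]) (j : Fin n) : Prop :=
  p ≠ 0 ∧
  IsGreatest {k : Fin n |
    shiftedDegree s p = (p k).degree.map (fun d : ℕ => (d : ℤ)) + (s k : WithBot ℤ)} j

/-- `P` is in `s`-Popov form: it has full rank, the `s`-pivot indices of its rows are strictly
increasing, the pivot entries are monic, and every other entry of a column which contains a pivot
has degree less than that pivot. -/
def IsPopov (s : Fin n → ℤ) (P : Matrix (Fin m) (Fin n) K[X]) : Prop :=
  LinearIndependent K[X] P.row ∧
  ∃ piv : Fin m → Fin n, StrictMono piv ∧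
    ∀ i, IsPivotIndex s (P.row i) (piv i) ∧ (P i (piv i)).Monic ∧
      ∀ i', i' ≠ i → (P i' (piv i)).degree < (P i (piv i)).degree

/-- The row space: the `K[X]`-module generated by the rows. -/
def rowSpace (P : Matrix (Fin m) (Fin n) K[X]) : Submodule K[X] (Fin n → K[X]) :=
  Submodule.span K[X] (Set.range P.row)

/-- `P` is an `s`-reduced form of `A`, and `P` is in `s`-Popov form. -/
def IsPopovFormOf (s : Fin n → ℤ) (A P : Matrix (Fin m) (Fin n) K[X]) : Prop :=
  rowSpace P = rowSpace A ∧ IsReduced s P ∧ IsPopov s P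

/-- The generic bound `σ(A) = max_π ∑_i deg' a_{i,π(i)}` on the degree of the determinant, where
`deg'` is the degree with `deg' 0 = 0`. -/
def genericDetBound (A : Matrix (Fin m) (Fin m) K[X]) : ℕ :=
  Finset.univ.sup fun π : Equiv.Perm (Fin m) => ∑ i, (A i (π i)).natDegree

/-- The degree of a matrix: the maximum of the degrees of its entries (`0` if there is no nonzero
entry). -/
def matDegree (A : Matrix (Fin m) (Fin n) K[X]) : ℕ :=
  Finset.univ.sup fun ij : Fin m × Fin n => (A ij.1 ij.2).natDegree

end Popov

/-! ### Straight-line constructions over a field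

A construction reads the coefficients of a polynomial matrix `A`, performs a list of field
operations, and assembles a new polynomial matrix, given by the lists of the coefficients of its
entries, and a shift. Its cost is the number of the field operations. It is itself a finite
combinatorial object, which mentions no field. -/

/-- The four field operations. -/
inductive FieldOp
  | add | sub | mul | div

/-- What is available without computation: the constants `0`, `1`, `-1`, the coefficient of `X ^ k`
in the entry `(i, j)` of the input (indices start at `0`), and the result of an earlier step. -/
inductive Operand
  | zero | one | negOne
  | coeff (i j k : ℕ)
  | result (r : ℕ)

/-- One step of a straight-line program: a field operation on two operands. -/
structure Step where
  op : FieldOp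
  fst : Operand
  snd : Operand

/-- A straight-line construction of a `dim × dim` polynomial matrix and of a shift:
`entries[i][j][k]` is the coefficient of `X ^ k` in the entry `(i, j)`. -/
structure Construction where
  steps : List Step
  dim : ℕ
  shift : List ℤ
  entries : List (List (List Operand))

/-- The codings of these finite objects (needed only to speak of computable functions). -/
def FieldOp.equiv : FieldOp ≃ Fin 4 where
  toFun | .add => 0 | .sub => 1 | .mul => 2 | .div => 3
  invFun | 0 => .add | 1 => .sub | 2 => .mul | 3 => .div
  left_inv x := by cases x <;> rfl
  right_inv x := by fin_cases x <;> rfl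

def Operand.equiv : Operand ≃ (Fin 3 ⊕ (ℕ × ℕ × ℕ)) ⊕ ℕ where
  toFun
    | .zero => .inl (.inl 0) | .one => .inl (.inl 1) | .negOne => .inl (.inl 2)
    | .coeff i j k => .inl (.inr (i, j, k))
    | .result r => .inr r
  invFun
    | .inl (.inl 0) => .zero | .inl (.inl 1) => .one | .inl (.inl 2) => .negOne
    | .inl (.inr (i, j, k)) => .coeff i j k
    | .inr r => .result r
  left_inv x := by cases x <;> rfl
  right_inv x := by
    rcases x with (x | x) | x
    · fin_cases x <;> rfl
    · rfl
    · rfl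

def Step.equiv : Step ≃ FieldOp × Operand × Operand where
  toFun t := (t.op, t.fst, t.snd)
  invFun t := ⟨t.1, t.2.1, t.2.2⟩

def Construction.equiv :
    Construction ≃ List Step × ℕ × List ℤ × List (List (List Operand)) where
  toFun c := (c.steps, c.dim, c.shift, c.entries)
  invFun c := ⟨c.1, c.2.1, c.2.2.1, c.2.2.2⟩

instance : Primcodable FieldOp := Primcodable.ofEquiv _ FieldOp.equiv
instance : Primcodable Operand := Primcodable.ofEquiv _ Operand.equiv
instance : Primcodable Step := Primcodable.ofEquiv _ Step.equiv
instance : Primcodable Construction := Primcodable.ofEquiv _ Construction.equiv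

section Run

variable {K : Type*} [Field K] {m : ℕ}

def FieldOp.apply : FieldOp → K → K → K
  | .add, x, y => x + y
  | .sub, x, y => x - y
  | .mul, x, y => x * y
  | .div, x, y => x / y

/-- The value of an operand on the input `A`, given the results of the earlier steps (`0` for an
index that is out of range). -/
def Operand.value (A : Matrix (Fin m) (Fin m) K[X]) (results : List K) : Operand → K
  | .zero => 0
  | .one => 1
  | .negOne => -1
  | .coeff i j k => if h : i < m ∧ j < m then (A ⟨i, h.1⟩ ⟨j, h.2⟩).coeff k else 0
  | .result r => results.getD r 0

/-- The results of the steps, in order, on the input `A`. -/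
def runSteps (A : Matrix (Fin m) (Fin m) K[X]) (steps : List Step) : List K :=
  steps.foldl
    (fun results t =>
      results ++ [t.op.apply (t.fst.value A results) (t.snd.value A results)]) []

/-- The polynomial with a given list of coefficients, from degree `0` upwards. -/
def ofCoeffs (l : List K) : K[X] :=
  ∑ k ∈ Finset.range l.length, C (l.getD k 0) * X ^ k

/-- The number of field operations that a construction performs. -/
def Construction.fieldOpCount (c : Construction) : ℕ := c.steps.length

/-- The matrix that a construction builds from the input `A`. -/
def Construction.matrix (c : Construction) (A : Matrix (Fin m) (Fin m) K[X]) :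
    Matrix (Fin c.dim) (Fin c.dim) K[X] :=
  Matrix.of fun i j =>
    ofCoeffs ((((c.entries.getD i []).getD j []).map
      (Operand.value A (runSteps A c.steps))))

/-- The shift that a construction builds. -/
def Construction.shiftFun (c : Construction) : Fin c.dim → ℤ :=
  fun i => c.shift.getD i 0

/-- The table of the degrees of the entries of `A` (with `0` for zero entries). -/
def degreeTable (A : Matrix (Fin m) (Fin m) K[X]) : List (List ℕ) :=
  List.ofFn fun i => List.ofFn fun j => (A i j).natDegree

end Run

end PolyMat

end

open PolyMat

/-! Let `D` be the sum of the degrees of the entries (pivots) along a permutation, chosen so that no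
entry exceeds both the pivot of its row and the pivot of its column. A permutation maximizing the
sum of `2 ^ degree` has this property, by exchange. Then `D ≤ σ(A)`. Let `e` be `⌈D / m⌉`, or `1` if
`D = 0`, and cut the entries into digits in base `X ^ e`.

An entry that does not exceed its row pivot puts its higher digits into extra rows; any other entry
is bounded by its column pivot and puts them into extra columns. If `d_i` is the degree of the pivot
of row `i`, then `⌊d_i / e⌋` extra indices suffice for row `i`, and as many for its pivot column.
Since `∑ ⌊d_i / e⌋ ≤ D / e ≤ m`, the dimension is at most `3m`. Entries of the new matrix `B` are
digits or built from `0`, `±1`, `±X ^ e`, so building it only copies coefficients.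

Why the Popov form survives: a linear map `Φ : K[X]^N → K[X]^m`, the identity on the first `m`
coordinates, sends the first `m` rows of `B` to the rows of `A` and the extra rows to `0`, and the
extra rows generate its kernel. Hence the row space of `B` is the preimage under `Φ` of that of `A`
(`rowSpace_linMatrix`). If `P` is the Popov form of `A` and the shift is large on the extra columns,
the Popov form of this preimage is `[P 0; -R I]`, with `R` a remainder modulo `P`
(`exists_popovShape_comap`). Here "large" is explicit, because the diagonal degrees of `P` are at
most `deg (det A)`.

Existence and uniqueness of Popov forms come from division with remainder for a term order on
`K[X]^n` (`exists_popovShape`, `PopovShape.eq`). The permutation is found by searching codes for one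
with the decidable exchange property, so the plan is computable from degrees and shift alone. -/

namespace PolyMat

/-! ### Pivots as leading monomials for a shifted term order. -/

section Monomials

variable {K : Type*} [Field K] {n : ℕ}

/-- An integer rank of the monomial `X ^ d e_j`, whose order is the one of the pairs
`(d + s_j, j)` under the lexicographic order. -/
def monomialRank (s : Fin n → ℤ) (j : Fin n) (d : ℕ) : ℤ := (d + s j) * n + j

/-- Indices lie in `[0, n)`, so one unit of shifted degree outweighs any difference of indices. -/
theorem monomialRank_le_iff (s : Fin n → ℤ) (j k : Fin n) (d e : ℕ) :
    monomialRank s k e ≤ monomialRank s j d ↔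
      (e : ℤ) + s k < d + s j ∨ ((e : ℤ) + s k = d + s j ∧ k ≤ j) := by
  have hj := j.2
  have hk := k.2
  unfold monomialRank
  rw [Fin.le_def]
  rcases lt_trichotomy ((e : ℤ) + s k) (d + s j) with h | h | h
  · simp only [h, true_or, iff_true]
    nlinarith
  · simp only [h, lt_irrefl, true_and, false_or]
    omega
  · have : ¬ ((e : ℤ) + s k < d + s j ∨ ((e : ℤ) + s k = d + s j ∧ (k : ℕ) ≤ j)) := by omega
    simp only [this, iff_false, not_le]
    nlinarith

theorem monomialRank_inj {s : Fin n → ℤ} {j k : Fin n} {d e : ℕ}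
    (h : monomialRank s k e = monomialRank s j d) : k = j ∧ e = d := by
  have h1 := (monomialRank_le_iff s j k d e).1 h.le
  have h2 := (monomialRank_le_iff s k j e d).1 h.ge
  have : k = j := by
    apply le_antisymm
    · rcases h1 with h1 | h1 <;> rcases h2 with h2 | h2 <;> omega
    · rcases h1 with h1 | h1 <;> rcases h2 with h2 | h2 <;> omega
  subst this
  refine ⟨rfl, ?_⟩
  omega

theorem monomialRank_add (s : Fin n → ℤ) (j : Fin n) (c d : ℕ) :
    monomialRank s j (c + d) = c * n + monomialRank s j d := by
  unfold monomialRank; push_cast; ring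

theorem monomialRank_mono (s : Fin n → ℤ) (j : Fin n) {c d : ℕ} :
    monomialRank s j c ≤ monomialRank s j d ↔ c ≤ d := by
  rw [monomialRank_le_iff]; simp; omega

/-- The monomial `X ^ deg v_j e_j` is the leading one of `v`. -/
def HasPivot (s : Fin n → ℤ) (v : Fin n → K[X]) (j : Fin n) : Prop :=
  v j ≠ 0 ∧ ∀ k, v k ≠ 0 →
    monomialRank s k (v k).natDegree ≤ monomialRank s j (v j).natDegree

theorem exists_hasPivot (s : Fin n → ℤ) {v : Fin n → K[X]} (hv : v ≠ 0) : ∃ j, HasPivot s v j := by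
  classical
  obtain ⟨i, hi⟩ := Function.ne_iff.1 hv
  obtain ⟨j, hj, hmax⟩ := Finset.exists_max_image (Finset.univ.filter fun k => v k ≠ 0)
    (fun k => monomialRank s k (v k).natDegree) ⟨i, by simpa using hi⟩
  exact ⟨j, by simpa using hj, fun k hk => hmax k (by simpa using hk)⟩

theorem HasPivot.unique {s : Fin n → ℤ} {v : Fin n → K[X]} {j k : Fin n}
    (hj : HasPivot s v j) (hk : HasPivot s v k) : j = k :=
  (monomialRank_inj (le_antisymm (hk.2 j hj.1) (hj.2 k hk.1))).1

theorem degree_map_add (p : K[X]) (hp : p ≠ 0) (a : ℤ) :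
    p.degree.map (fun d : ℕ => (d : ℤ)) + (a : WithBot ℤ) =
      (((p.natDegree : ℤ) + a : ℤ) : WithBot ℤ) := by
  rw [degree_eq_natDegree hp]; rfl

theorem HasPivot.shiftedDegree_eq {s : Fin n → ℤ} {v : Fin n → K[X]} {j : Fin n}
    (h : HasPivot s v j) :
    shiftedDegree s v = (((v j).natDegree + s j : ℤ) : WithBot ℤ) := by
  unfold shiftedDegree
  apply le_antisymm
  · refine Finset.sup_le fun k _ => ?_
    by_cases hk : v k = 0
    · simp [hk]
    · rw [degree_map_add _ hk]
      have := (monomialRank_le_iff s j k _ _).1 (h.2 k hk)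
      exact_mod_cast (by omega : ((v k).natDegree + s k : ℤ) ≤ (v j).natDegree + s j)
  · rw [← degree_map_add _ h.1]
    exact Finset.le_sup (f := fun j => (v j).degree.map (fun d : ℕ => (d : ℤ)) + (s j : WithBot ℤ))
      (Finset.mem_univ j)

theorem HasPivot.isPivotIndex {s : Fin n → ℤ} {v : Fin n → K[X]} {j : Fin n}
    (h : HasPivot s v j) : IsPivotIndex s v j := by
  refine ⟨fun h0 => h.1 (by simp [h0]), ?_, ?_⟩
  · simp only [Set.mem_ofPred_eq]
    rw [h.shiftedDegree_eq, degree_map_add _ h.1]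
  · intro k hk
    simp only [Set.mem_ofPred_eq] at hk
    rw [h.shiftedDegree_eq] at hk
    have hk0 : v k ≠ 0 := by
      rintro h0
      rw [h0] at hk
      exact WithBot.coe_ne_bot (hk.trans (by simp))
    rw [degree_map_add _ hk0, WithBot.coe_inj] at hk
    have := (monomialRank_le_iff s j k _ _).1 (h.2 k hk0)
    omega

theorem isPivotIndex_iff {s : Fin n → ℤ} {v : Fin n → K[X]} {j : Fin n} :
    IsPivotIndex s v j ↔ HasPivot s v j := by
  refine ⟨fun h => ?_, HasPivot.isPivotIndex⟩
  obtain ⟨k, hk⟩ := exists_hasPivot s h.1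
  rwa [h.2.unique hk.isPivotIndex.2]

/-- A square matrix in Popov form, the pivots being then on the diagonal. -/
structure PopovShape (s : Fin n → ℤ) (P : Matrix (Fin n) (Fin n) K[X]) : Prop where
  pivot : ∀ i, HasPivot s (P i) i
  monic : ∀ i, (P i i).Monic
  lt : ∀ i k, k ≠ i → (P k i).degree < (P i i).degree

/-- A strictly increasing self-map of `Fin n` is the identity, so the pivots of a square Popov
matrix are diagonal. -/
theorem isPopov_iff {s : Fin n → ℤ} {P : Matrix (Fin n) (Fin n) K[X]} :
    IsPopov s P ↔ LinearIndependent K[X] P.row ∧ PopovShape s P := by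
  refine and_congr_right fun _ => ⟨?_, fun h => ⟨id, strictMono_id, fun i =>
    ⟨(h.pivot i).isPivotIndex, h.monic i, h.lt i⟩⟩⟩
  rintro ⟨piv, hmono, h⟩
  have hid : piv = id := by
    have : Set.range piv = Set.univ :=
      Set.range_eq_univ.2 (Finite.injective_iff_surjective.1 hmono.injective)
    exact StrictMono.range_inj hmono strictMono_id |>.1 (by simp [this])
  subst hid
  exact ⟨fun i => isPivotIndex_iff.1 (h i).1, fun i => (h i).2.1, fun i => (h i).2.2⟩

/-- The pivot is the last place where the row degree is attained and is monic, so the leading matrix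
is lower triangular with ones on the diagonal. -/
theorem PopovShape.linearIndependent_leadingMatrix {s : Fin n → ℤ} {P : Matrix (Fin n) (Fin n) K[X]}
    (h : PopovShape s P) : LinearIndependent K (leadingMatrix s P).row := by
  rw [Matrix.linearIndependent_rows_iff_isUnit, Matrix.isUnit_iff_isUnit_det]
  have hd (i) : (shiftedDegree s (P.row i)).unbotD 0 = (P i i).natDegree + s i := by
    rw [show P.row i = P i from rfl, (h.pivot i).shiftedDegree_eq]; rfl
  rw [Matrix.det_of_isLowerTriangular]
  · rw [Finset.prod_eq_one]
    · exact isUnit_one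
    · intro i _
      simp only [leadingMatrix, Matrix.of_apply, hd]
      rw [if_pos (by omega)]
      simpa using (h.monic i).coeff_natDegree
  · intro i j hij
    simp only [leadingMatrix, Matrix.of_apply, hd]
    split_ifs with hle
    · by_cases h0 : P i j = 0
      · simp [h0]
      · apply coeff_eq_zero_of_natDegree_lt
        have := (monomialRank_le_iff s i j _ _).1 ((h.pivot i).2 j h0)
        have hij' : i < j := by simpa using hij
        have : ¬ j ≤ i := not_le.2 hij'
        simp only [this, and_false, or_false] at *
        omega
    · rfl

end Monomials

/-! ### Row spaces and nonsingularity. -/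

section RowSpace

variable {K : Type*} [Field K] {n : ℕ}

theorem mem_rowSpace_iff {m : ℕ} {P : Matrix (Fin m) (Fin n) K[X]} {v : Fin n → K[X]} :
    v ∈ rowSpace P ↔ ∃ c : Fin m → K[X], ∑ i, c i • P i = v := by
  unfold rowSpace
  rw [Submodule.mem_span_range_iff_exists_fun]; rfl

theorem row_mem_rowSpace {m : ℕ} (P : Matrix (Fin m) (Fin n) K[X]) (i : Fin m) :
    P i ∈ rowSpace P := Submodule.subset_span ⟨i, rfl⟩

theorem det_smul_mem_rowSpace (A : Matrix (Fin n) (Fin n) K[X]) (v : Fin n → K[X]) :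
    A.det • v ∈ rowSpace A := by
  rw [mem_rowSpace_iff]
  refine ⟨Matrix.vecMul v A.adjugate, ?_⟩
  have : Matrix.vecMul (Matrix.vecMul v A.adjugate) A = A.det • v := by
    rw [Matrix.vecMul_vecMul, Matrix.adjugate_mul, Matrix.vecMul_smul, Matrix.vecMul_one]
  rw [← this]
  exact (Matrix.vecMul_eq_sum _ _).symm

/-- The combinations form a matrix `B` with `B * A = c • 1`; take determinants. -/
theorem det_ne_zero_of_smul_mem_rowSpace {A : Matrix (Fin n) (Fin n) K[X]} {c : K[X]} (hc : c ≠ 0)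
    (h : ∀ j, c • (Pi.single j 1 : Fin n → K[X]) ∈ rowSpace A) : A.det ≠ 0 := by
  choose B hB using fun j => mem_rowSpace_iff.1 (h j)
  have : (Matrix.of B) * A = c • (1 : Matrix (Fin n) (Fin n) K[X]) := by
    ext i j
    have := congrFun (hB i) j
    simp only [Finset.sum_apply, Pi.smul_apply, smul_eq_mul] at this
    rw [Matrix.mul_apply]
    simp only [Matrix.of_apply, this, Matrix.smul_apply, smul_eq_mul, Matrix.one_apply,
      Pi.single_apply]
    simp [eq_comm]
  intro h0
  have h1 := congrArg Matrix.det this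
  rw [Matrix.det_mul, h0, mul_zero, Matrix.det_smul, Matrix.det_one, mul_one] at h1
  exact pow_ne_zero _ hc h1.symm

theorem linearIndependent_row_of_det_ne_zero {A : Matrix (Fin n) (Fin n) K[X]} (h : A.det ≠ 0) :
    LinearIndependent K[X] A.row :=
  Matrix.linearIndependent_rows_of_det_ne_zero h

end RowSpace

end PolyMat

namespace PolyMat

/-! ### Existence and uniqueness of the Popov form. -/

section PopovForm

variable {K : Type*} [Field K] {n : ℕ}

theorem HasPivot.smul_row_rank_le {s : Fin n → ℤ} {v : Fin n → K[X]} {j : Fin n}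
    (h : HasPivot s v j) {c : K[X]} {k : Fin n} (hk : c * v k ≠ 0) :
    monomialRank s k (c * v k).natDegree ≤ monomialRank s j (c.natDegree + (v j).natDegree) := by
  have hc := left_ne_zero_of_mul hk
  have hv := right_ne_zero_of_mul hk
  rw [natDegree_mul hc hv, monomialRank_add, monomialRank_add]
  have := h.2 k hv
  omega

/-- The leading monomial of a combination of the rows is a multiple of that of one of the rows. -/
theorem exists_hasPivot_sum {s : Fin n → ℤ} {P : Fin n → Fin n → K[X]}
    (hP : ∀ i, HasPivot s (P i) i) {c : Fin n → K[X]} (hc : c ≠ 0) :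
    ∃ j, HasPivot s (∑ i, c i • P i) j ∧
      (P j j).natDegree ≤ ((∑ i, c i • P i) j).natDegree := by
  classical
  obtain ⟨i₀, hi₀⟩ := Function.ne_iff.1 hc
  -- The summand with the highest leading monomial wins: leading monomials of different summands lie
  -- in different columns, so they cannot tie and cancel.
  obtain ⟨j, hj, hmax⟩ := Finset.exists_max_image (Finset.univ.filter fun k => c k ≠ 0)
    (fun k => monomialRank s k ((c k).natDegree + (P k k).natDegree)) ⟨i₀, by simpa using hi₀⟩
  simp only [Finset.mem_filter, Finset.mem_univ, true_and] at hj hmax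
  set D := (c j).natDegree + (P j j).natDegree with hD
  have hjj : c j * P j j ≠ 0 := mul_ne_zero hj (hP j).1
  have hdeg : (∑ i, c i * P i j).degree = D := by
    rw [← Finset.add_sum_erase _ _ (Finset.mem_univ j), degree_add_eq_left_of_degree_lt,
      degree_eq_natDegree hjj, natDegree_mul hj (hP j).1]
    rw [degree_eq_natDegree hjj, natDegree_mul hj (hP j).1, degree_lt_iff_coeff_zero]
    intro N hN
    rw [finsetSum_coeff]
    refine Finset.sum_eq_zero fun i hi => ?_
    by_cases h0 : c i * P i j = 0
    · simp [h0]
    apply coeff_eq_zero_of_natDegree_lt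
    have h1 := ((hP i).smul_row_rank_le h0).trans (hmax i (left_ne_zero_of_mul h0))
    have h2 : (c i * P i j).natDegree ≤ D := (monomialRank_mono s j).1 h1
    rcases h2.lt_or_eq with h2 | h2
    · exact h2.trans_le hN
    · exfalso
      have h3 := le_antisymm (hmax i (left_ne_zero_of_mul h0))
        (h2 ▸ (hP i).smul_row_rank_le h0)
      exact (Finset.mem_erase.1 hi).1 (monomialRank_inj h3).1
  have hval (k) : (∑ i, c i • P i) k = ∑ i, c i * P i k := by simp
  have hnat : (∑ i, c i * P i j).natDegree = D := natDegree_eq_of_degree_eq_some hdeg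
  refine ⟨j, ⟨?_, fun k hk => ?_⟩, ?_⟩
  · rw [hval]
    intro h0
    rw [h0, degree_zero] at hdeg
    exact absurd hdeg (by simp)
  · rw [hval j, hnat]
    rw [hval k] at hk ⊢
    set N := (∑ i, c i * P i k).natDegree with hN
    have h1 : (∑ i, c i * P i k).coeff N ≠ 0 := by simpa [hN] using hk
    rw [finsetSum_coeff] at h1
    obtain ⟨i, -, hi⟩ := Finset.exists_ne_zero_of_sum_ne_zero h1
    have h0 : c i * P i k ≠ 0 := by rintro h; simp [h] at hi
    have h2 : N ≤ (c i * P i k).natDegree := le_natDegree_of_ne_zero hi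
    exact ((monomialRank_mono s k).2 h2).trans
      (((hP i).smul_row_rank_le h0).trans (hmax i (left_ne_zero_of_mul h0)))
  · rw [hval, hnat]; omega

/-- The rows behave as a Gröbner basis: the leading monomial of `v` is a multiple of that of row
`j`. Thus diagonal degrees are invariants of the row space. -/
theorem PopovShape.natDegree_le {s : Fin n → ℤ} {P : Matrix (Fin n) (Fin n) K[X]}
    (hP : ∀ i, HasPivot s (P i) i) {v : Fin n → K[X]} (hv : v ∈ rowSpace P) {j : Fin n}
    (hj : HasPivot s v j) : (P j j).natDegree ≤ (v j).natDegree := by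
  obtain ⟨c, rfl⟩ := mem_rowSpace_iff.1 hv
  have hc : c ≠ 0 := by rintro rfl; exact hj.1 (by simp)
  obtain ⟨k, hk, hle⟩ := exists_hasPivot_sum hP hc
  rwa [hj.unique hk]

/-- The zero vector is the only reduced element of a submodule whose elements have at least the
given pivot degrees. -/
theorem eq_zero_of_degree_lt {s : Fin n → ℤ} {M : Submodule K[X] (Fin n → K[X])} {d : Fin n → ℕ}
    (hM : ∀ v ∈ M, ∀ j, HasPivot s v j → d j ≤ (v j).natDegree) {v : Fin n → K[X]} (hv : v ∈ M)
    (hlt : ∀ k, (v k).degree < d k) : v = 0 := by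
  by_contra h0
  obtain ⟨j, hj⟩ := exists_hasPivot s h0
  have h1 := hM v hv j hj
  have h2 := hlt j
  rw [degree_eq_natDegree hj.1] at h2
  exact absurd (Nat.cast_lt.1 h2) (not_lt.2 h1)

/-- The diagonal degrees agree by minimality. The difference of corresponding rows is then in the
module with every column below its pivot degree, hence zero. -/
theorem PopovShape.eq {s : Fin n → ℤ} {P Q : Matrix (Fin n) (Fin n) K[X]}
    (hP : PopovShape s P) (hQ : PopovShape s Q) (h : rowSpace P = rowSpace Q) : P = Q := by
  have hd (j) : (P j j).natDegree = (Q j j).natDegree :=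
    le_antisymm (natDegree_le hP.pivot (h ▸ row_mem_rowSpace Q j) (hQ.pivot j))
      (natDegree_le hQ.pivot (h ▸ row_mem_rowSpace P j) (hP.pivot j))
  have hdeg (j) : (P j j).degree = (Q j j).degree := by
    rw [degree_eq_natDegree (hP.monic j).ne_zero, degree_eq_natDegree (hQ.monic j).ne_zero, hd]
  funext j
  rw [← sub_eq_zero]
  refine eq_zero_of_degree_lt (s := s) (M := rowSpace P) (d := fun k => (P k k).natDegree)
    (fun v hv k hk => natDegree_le hP.pivot hv hk)
    (sub_mem (row_mem_rowSpace P j) (h ▸ row_mem_rowSpace Q j)) fun k => ?_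
  rw [← degree_eq_natDegree (hP.monic k).ne_zero, Pi.sub_apply]
  by_cases hk : j = k
  · subst hk
    exact degree_sub_lt_left (hdeg j) (hP.monic j).ne_zero
      (by rw [(hP.monic j).leadingCoeff, (hQ.monic j).leadingCoeff])
  · exact (degree_sub_le _ _).trans_lt (max_lt (hP.lt k j hk) (hdeg k ▸ hQ.lt k j hk))

theorem sum_single_monomial (v : Fin n → K[X]) :
    v = ∑ k, ∑ e ∈ (v k).support, Pi.single k (monomial e ((v k).coeff e)) := by
  classical
  have h1 (k) : ∑ e ∈ (v k).support, (Pi.single k (monomial e ((v k).coeff e)) : Fin n → K[X]) =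
      Pi.single k (v k) := by
    conv_rhs => rw [(v k).as_sum_support]
    exact (map_sum (AddMonoidHom.single (fun _ : Fin n => K[X]) k) _ _).symm
  simp only [h1, Finset.univ_sum_single]

/-- Division with remainder by vectors with prescribed leading monomials. -/
theorem exists_sub_degree_lt {s : Fin n → ℤ} {N : Submodule K[X] (Fin n → K[X])}
    {q : Fin n → Fin n → K[X]} (hq : ∀ j, q j ∈ N) (hpiv : ∀ j, HasPivot s (q j) j)
    (v : Fin n → K[X]) :
    ∃ w ∈ N, ∀ k, ((v - w) k).degree < (q k k).natDegree := by
  classical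
  -- Being reducible is stable under sums, so it suffices to reduce single monomials.
  have hsum : ∀ (ι : Type) (F : Finset ι) (f : ι → Fin n → K[X]),
      (∀ i ∈ F, ∃ w ∈ N, ∀ k, ((f i - w) k).degree < (q k k).natDegree) →
      ∃ w ∈ N, ∀ k, ((∑ i ∈ F, f i - w) k).degree < (q k k).natDegree := by
    intro ι F f hF
    choose! w hw hlt using hF
    refine ⟨∑ i ∈ F, w i, sum_mem hw, fun k => ?_⟩
    rw [← Finset.sum_sub_distrib, Finset.sum_apply]
    refine (degree_sum_le _ _).trans_lt ?_
    rw [Finset.sup_lt_iff (by exact WithBot.bot_lt_coe _)]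
    exact fun i hi => hlt i hi k
  obtain ⟨b, hb⟩ : ∃ b : ℤ, ∀ j, b ≤ monomialRank s j 0 := by
    obtain ⟨b, hb⟩ := (Set.finite_range fun j => monomialRank s j 0).bddBelow
    exact ⟨b, fun j => hb ⟨j, rfl⟩⟩
  -- Induction on the rank is legitimate because ranks are integers bounded below by `b`.
  have key : ∀ r : ℕ, ∀ j d a, monomialRank s j d < b + r →
      ∃ w ∈ N, ∀ k, (((Pi.single j (monomial d a) : Fin n → K[X]) - w) k).degree <
        (q k k).natDegree := by
    intro r
    induction r with
    | zero =>
      intro j d a h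
      have := (hb j).trans ((monomialRank_mono s j).2 (Nat.zero_le d))
      push_cast at h
      omega
    | succ r ih =>
      intro j d a hr
      by_cases hd : d < (q j j).natDegree
      · refine ⟨0, zero_mem _, fun k => ?_⟩
        rw [sub_zero]
        by_cases hk : k = j
        · subst hk
          rw [Pi.single_eq_same]
          exact (degree_monomial_le _ _).trans_lt (Nat.cast_lt.2 hd)
        · rw [Pi.single_eq_of_ne hk]
          exact WithBot.bot_lt_coe _
      push Not at hd
      by_cases ha : a = 0
      · subst ha
        exact ⟨0, zero_mem _, fun k => by simp⟩
      set lc := (q j j).leadingCoeff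
      have hlc : lc ≠ 0 := leadingCoeff_ne_zero.2 (hpiv j).1
      set c : K[X] := monomial (d - (q j j).natDegree) (a / lc) with hc
      have hcdeg : c.natDegree = d - (q j j).natDegree := by
        rw [hc, natDegree_monomial, if_neg (div_ne_zero ha hlc)]
      -- The multiple of `q j` cancels the monomial; everything left has strictly smaller rank.
      set v' : Fin n → K[X] := Pi.single j (monomial d a) - c • q j with hv'
      suffices h : ∃ w ∈ N, ∀ k, ((v' - w) k).degree < (q k k).natDegree by
        obtain ⟨w, hw, hlt⟩ := h
        refine ⟨c • q j + w, add_mem (N.smul_mem _ (hq j)) hw, fun k => ?_⟩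
        rw [← sub_sub]
        exact hlt k
      rw [sum_single_monomial v']
      refine hsum _ _ _ fun k _ => hsum _ _ _ fun e he => ih k e _ ?_
      rw [mem_support_iff] at he
      have hle : monomialRank s k e ≤ monomialRank s j d := by
        by_cases h1 : (c * q j k).coeff e = 0
        · have h2 : (Pi.single j (monomial d a) : Fin n → K[X]) k ≠ 0 := by
            rintro h2
            rw [hv', Pi.sub_apply, h2, Pi.smul_apply, smul_eq_mul, zero_sub, coeff_neg, h1] at he
            simp at he
          have hkj : k = j := by
            by_contra hkj; exact h2 (Pi.single_eq_of_ne hkj _)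
          subst hkj
          rw [hv', Pi.sub_apply, Pi.smul_apply, smul_eq_mul, coeff_sub, h1, Pi.single_eq_same,
            coeff_monomial, sub_zero] at he
          have : d = e := by by_contra h; simp [h] at he
          rw [this]
        · have h0 : c * q j k ≠ 0 := by rintro h; simp [h] at h1
          refine ((monomialRank_mono s k).2 (le_natDegree_of_ne_zero h1)).trans
            (((hpiv j).smul_row_rank_le h0).trans ?_)
          rw [hcdeg, Nat.sub_add_cancel hd]
      rcases hle.lt_or_eq with h | h
      · push_cast at hr; omega
      · exfalso
        obtain ⟨rfl, rfl⟩ := monomialRank_inj h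
        apply he
        rw [hv', Pi.sub_apply, Pi.smul_apply, smul_eq_mul, coeff_sub, Pi.single_eq_same,
          coeff_monomial, if_pos rfl, hc, ← C_mul_X_pow_eq_monomial, mul_assoc, coeff_C_mul,
          coeff_X_pow_mul', if_pos (Nat.sub_le _ _), Nat.sub_sub_self hd, coeff_natDegree,
          div_mul_cancel₀ _ hlc, sub_self]
  rw [sum_single_monomial v]
  refine hsum _ _ _ fun k _ => hsum _ _ _ fun e he =>
    key (monomialRank s k e - b + 1).toNat k e _ ?_
  omega

/-- Since `c • e_j ∈ M`, every index occurs as a pivot, in degree at most `deg c`. Choose vectors `q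
j` of minimal pivot degree `d j`; row `j` is `X ^ d j • e_j` minus its remainder modulo the `q`. -/
theorem exists_popovShape (s : Fin n → ℤ) {M : Submodule K[X] (Fin n → K[X])} {c : K[X]}
    (hc : c ≠ 0) (hM : ∀ v, c • v ∈ M) :
    ∃ P : Matrix (Fin n) (Fin n) K[X], PopovShape s P ∧ rowSpace P = M ∧
      ∀ j, (P j j).natDegree ≤ c.natDegree := by
  classical
  have hex (j) : ∃ d, ∃ v ∈ M, HasPivot s v j ∧ (v j).natDegree = d := by
    refine ⟨_, _, hM (Pi.single j 1), ⟨by simpa using hc, fun k hk => ?_⟩, rfl⟩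
    have : k = j := by
      by_contra h; simp [Pi.single_eq_of_ne h] at hk
    rw [this]
  have hmin (j) : ∃ v ∈ M, HasPivot s v j ∧
      ∀ w ∈ M, HasPivot s w j → (v j).natDegree ≤ (w j).natDegree := by
    obtain ⟨v, hv, hp, hd⟩ := Nat.find_spec (hex j)
    exact ⟨v, hv, hp, fun w hw hwp => hd ▸ Nat.find_min' (hex j) ⟨w, hw, hwp, rfl⟩⟩
  choose q hqM hqpiv hqmin using hmin
  set d : Fin n → ℕ := fun j => (q j j).natDegree with hd
  have hdM : ∀ v ∈ M, ∀ j, HasPivot s v j → d j ≤ (v j).natDegree :=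
    fun v hv j hj => hqmin j v hv hj
  choose P hPM hPlt using fun j =>
    exists_sub_degree_lt hqM hqpiv (Pi.single j (X ^ d j : K[X]))
  have hoff (i k) (hk : k ≠ i) : (P k i).degree < (d i : WithBot ℕ) := by
    have := hPlt k i
    rwa [Pi.sub_apply, Pi.single_eq_of_ne hk.symm, zero_sub, degree_neg] at this
  have hdiag (i) : P i i = X ^ d i + (P i i - X ^ d i) ∧
      (P i i - X ^ d i).degree < (d i : WithBot ℕ) := by
    refine ⟨by ring, ?_⟩
    have := hPlt i i
    rwa [Pi.sub_apply, Pi.single_eq_same, ← degree_neg, neg_sub] at this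
  have hmonic (i) : (P i i).Monic := by
    rw [(hdiag i).1]
    exact monic_X_pow_add (hdiag i).2
  have hdeg (i) : (P i i).degree = (d i : WithBot ℕ) := by
    rw [(hdiag i).1, degree_add_eq_left_of_degree_lt, degree_X_pow]
    rw [degree_X_pow]; exact (hdiag i).2
  have hnat (i) : (P i i).natDegree = d i := natDegree_eq_of_degree_eq_some (hdeg i)
  have hpiv (i) : HasPivot s (P i) i := by
    obtain ⟨k, hk⟩ := exists_hasPivot s (v := P i)
      (fun h0 => (hmonic i).ne_zero (by rw [h0]; rfl))
    -- Off column `i` the row has degrees below the minimal pivot degrees, so its pivot can only be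
    -- `i`.
    by_cases hki : i = k
    · rwa [← hki] at hk
    · have h1 := hdM _ (hPM i) k hk
      have h2 := hoff k i hki
      rw [degree_eq_natDegree hk.1] at h2
      exact absurd (Nat.cast_lt.1 h2) (not_lt.2 h1)
  refine ⟨P, ⟨hpiv, hmonic, fun i k hk => hdeg i ▸ hoff i k hk⟩, le_antisymm ?_ ?_, fun j => ?_⟩
  · exact Submodule.span_le.2 (by rintro _ ⟨i, rfl⟩; exact hPM i)
  · intro v hv
    obtain ⟨w, hw, hlt⟩ := exists_sub_degree_lt (N := rowSpace (Matrix.of P))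
      (row_mem_rowSpace (Matrix.of P)) hpiv v
    have hwM : w ∈ M := (Submodule.span_le.2 (by rintro _ ⟨i, rfl⟩; exact hPM i) :
      rowSpace (Matrix.of P) ≤ M) hw
    have := eq_zero_of_degree_lt hdM (sub_mem hv hwM) fun k => (hlt k).trans_eq (by
      exact congrArg _ (hnat k))
    rw [sub_eq_zero] at this
    rw [this]; exact hw
  · rw [hnat]
    obtain ⟨k, hk⟩ : ∃ k, HasPivot s (c • (Pi.single j 1 : Fin n → K[X])) k :=
      exists_hasPivot s fun h => hc (by simpa using congrFun h j)
    have hkj : k = j := by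
      by_contra h; exact hk.1 (by simp [Pi.single_eq_of_ne h])
    subst hkj
    simpa using hdM _ (hM _) k hk

theorem isPopovFormOf_iff_eq {s : Fin n → ℤ} {A P : Matrix (Fin n) (Fin n) K[X]}
    (hA : A.det ≠ 0) (hP : PopovShape s P) (h : rowSpace P = rowSpace A)
    (Q : Matrix (Fin n) (Fin n) K[X]) : IsPopovFormOf s A Q ↔ Q = P := by
  constructor
  · rintro ⟨hQA, -, hQ⟩
    exact (isPopov_iff.1 hQ).2.eq hP (hQA.trans h.symm)
  · rintro rfl
    have hli := linearIndependent_row_of_det_ne_zero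
      (det_ne_zero_of_smul_mem_rowSpace hA fun j => h ▸ det_smul_mem_rowSpace A _)
    exact ⟨h, ⟨hli, hP.linearIndependent_leadingMatrix⟩, isPopov_iff.2 ⟨hli, hP⟩⟩

end PopovForm

end PolyMat

namespace PolyMat

/-! ### The Popov form of a preimage. -/

section Block

variable {K : Type*} [Field K] {m N : ℕ}

/-- Extension of a vector by zeros. -/
noncomputable def extendZero (N : ℕ) (p : Fin m → K[X]) : Fin N → K[X] :=
  fun y => if hy : (y : ℕ) < m then p ⟨y, hy⟩ else 0

theorem extendZero_of_lt (p : Fin m → K[X]) {y : Fin N} (hy : (y : ℕ) < m) :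
    extendZero N p y = p ⟨y, hy⟩ := dif_pos hy

theorem extendZero_of_le (p : Fin m → K[X]) {y : Fin N} (hy : m ≤ (y : ℕ)) :
    extendZero N p y = 0 := dif_neg (not_lt.2 hy)

variable (K m N) in
/-- Extension of a vector by zeros, as a linear map. -/
noncomputable def extendZeroₗ : (Fin m → K[X]) →ₗ[K[X]] (Fin N → K[X]) where
  toFun := extendZero N
  map_add' p q := by
    funext y; by_cases hy : (y : ℕ) < m <;> simp [extendZero, hy]
  map_smul' c p := by
    funext y; by_cases hy : (y : ℕ) < m <;> simp [extendZero, hy]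

/-- The Popov form of the preimage of a row space under a linear map which is the identity on the
first `m` coordinates, when the shifts of the other coordinates are large. -/
theorem exists_popovShape_comap (h : m ≤ N) {s : Fin m → ℤ} {P : Matrix (Fin m) (Fin m) K[X]}
    (hP : PopovShape s P) {u : Fin N → ℤ} (hu : ∀ i, u (Fin.castLE h i) = s i)
    (hu' : ∀ x : Fin N, m ≤ x → ∀ k, (P k k).natDegree + s k ≤ u x)
    (Φ : (Fin N → K[X]) →ₗ[K[X]] (Fin m → K[X])) (hΦ : ∀ p, Φ (extendZeroₗ K m N p) = p) :
    ∃ Q : Matrix (Fin N) (Fin N) K[X], PopovShape u Q ∧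
      rowSpace Q = (rowSpace P).comap Φ ∧
      Q.submatrix (Fin.castLE h) (Fin.castLE h) = P := by
  classical
  choose w hw hlt using fun x : Fin N =>
    exists_sub_degree_lt (row_mem_rowSpace P) hP.pivot (Φ (Pi.single x 1))
  set r : Fin N → Fin m → K[X] := fun x => Φ (Pi.single x 1) - w x with hr
  -- The block matrix `[P 0; -r I]`. `Φ` sends an extra row to `Φ e_x - r x = w x`, which lies in
  -- the row space of `P`.
  set Q : Matrix (Fin N) (Fin N) K[X] := fun x =>
    if hx : (x : ℕ) < m then extendZeroₗ K m N (P ⟨x, hx⟩)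
    else Pi.single x 1 - extendZeroₗ K m N (r x) with hQ
  have hdegP (k) : (P k k).degree = (P k k).natDegree :=
    degree_eq_natDegree (hP.monic k).ne_zero
  have hrlt (x k) : (r x k).degree < (P k k).degree := hdegP k ▸ hlt x k
  have q1 (x y : Fin N) (hx : (x : ℕ) < m) (hy : (y : ℕ) < m) : Q x y = P ⟨x, hx⟩ ⟨y, hy⟩ := by
    simp only [hQ, dif_pos hx]; exact extendZero_of_lt _ hy
  have q2 (x y : Fin N) (hx : (x : ℕ) < m) (hy : m ≤ (y : ℕ)) : Q x y = 0 := by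
    simp only [hQ, dif_pos hx]; exact extendZero_of_le _ hy
  have q3 (x y : Fin N) (hx : m ≤ (x : ℕ)) (hy : (y : ℕ) < m) : Q x y = - r x ⟨y, hy⟩ := by
    simp only [hQ, dif_neg (not_lt.2 hx), Pi.sub_apply]
    rw [Pi.single_eq_of_ne (by rintro rfl; omega), zero_sub]
    exact congrArg _ (extendZero_of_lt _ hy)
  have q4 (x y : Fin N) (hx : m ≤ (x : ℕ)) (hy : m ≤ (y : ℕ)) :
      Q x y = (Pi.single x 1 : Fin N → K[X]) y := by
    simp only [hQ, dif_neg (not_lt.2 hx), Pi.sub_apply]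
    rw [sub_eq_self]; exact extendZero_of_le _ hy
  have hmonic (x) : (Q x x).Monic := by
    by_cases hx : (x : ℕ) < m
    · rw [q1 x x hx hx]; exact hP.monic _
    · rw [q4 x x (not_lt.1 hx) (not_lt.1 hx), Pi.single_eq_same]; exact monic_one
  have hcast (x : Fin N) (hx : (x : ℕ) < m) : u x = s ⟨x, hx⟩ := hu ⟨x, hx⟩
  refine ⟨Q, ⟨fun x => ⟨(hmonic x).ne_zero, fun y hy => ?_⟩, hmonic, fun x y hyx => ?_⟩, ?_, ?_⟩
  · rw [monomialRank_le_iff]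
    by_cases hx : (x : ℕ) < m
    · by_cases hy' : (y : ℕ) < m
      · rw [q1 x y hx hy'] at hy ⊢
        have := (monomialRank_le_iff _ _ _ _ _).1 ((hP.pivot ⟨x, hx⟩).2 _ hy)
        rw [q1 x x hx hx, hcast x hx, hcast y hy']
        exact this
      · exact absurd (q2 x y hx (not_lt.1 hy')) hy
    · have hx := not_lt.1 hx
      by_cases hy' : (y : ℕ) < m
      · rw [q3 x y hx hy'] at hy ⊢
        left
        -- This is where the size of `u x` matters: the constant `1` in column `x` must beat the
        -- remainder.
        have h1 := natDegree_lt_natDegree (by simpa using hy) (hrlt x ⟨y, hy'⟩)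
        have h2 := hu' x hx ⟨y, hy'⟩
        rw [natDegree_neg, hcast y hy']
        omega
      · rw [q4 x y hx (not_lt.1 hy')] at hy
        have : y = x := by by_contra hne; exact hy (Pi.single_eq_of_ne hne _)
        subst this
        right; simp
  · by_cases hx : (x : ℕ) < m
    · rw [q1 x x hx hx]
      by_cases hy : (y : ℕ) < m
      · rw [q1 y x hy hx]
        exact hP.lt _ _ (by simpa [Fin.ext_iff] using hyx)
      · rw [q3 y x (not_lt.1 hy) hx, degree_neg]
        exact hrlt _ _
    · have hx := not_lt.1 hx
      rw [q4 x x hx hx, Pi.single_eq_same, degree_one]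
      by_cases hy : (y : ℕ) < m
      · rw [q2 y x hy hx]; simp
      · rw [q4 y x (not_lt.1 hy) hx, Pi.single_eq_of_ne hyx.symm]; simp
  · have hιmem (p) (hp : p ∈ rowSpace P) : extendZeroₗ K m N p ∈ rowSpace Q := by
      obtain ⟨c, rfl⟩ := mem_rowSpace_iff.1 hp
      rw [map_sum]
      refine sum_mem fun i _ => ?_
      rw [map_smul]
      refine Submodule.smul_mem _ _ ?_
      have : Q (Fin.castLE h i) = extendZeroₗ K m N (P i) := by
        simp [hQ]
      rw [← this]
      exact row_mem_rowSpace Q _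
    apply le_antisymm
    · refine Submodule.span_le.2 ?_
      rintro _ ⟨x, rfl⟩
      change Φ (Q x) ∈ rowSpace P
      by_cases hx : (x : ℕ) < m
      · simp only [hQ, dif_pos hx, hΦ]
        exact row_mem_rowSpace P _
      · simp only [hQ, dif_neg hx, map_sub, hΦ, hr]
        rw [sub_sub_cancel]; exact hw x
    -- Modulo the row space of `Q`, every vector equals the extension of its image; by linearity
    -- unit vectors suffice.
    · have key (v : Fin N → K[X]) : v - extendZeroₗ K m N (Φ v) ∈ rowSpace Q := by
        have hv : v = ∑ x, v x • (Pi.single x 1 : Fin N → K[X]) := by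
          conv_lhs => rw [← Finset.univ_sum_single v]
          exact Finset.sum_congr rfl fun x _ => by
            rw [← Pi.single_smul, smul_eq_mul, mul_one]
        rw [hv, map_sum, map_sum, ← Finset.sum_sub_distrib]
        refine sum_mem fun x _ => ?_
        rw [map_smul, map_smul, ← smul_sub]
        refine Submodule.smul_mem _ _ ?_
        by_cases hx : (x : ℕ) < m
        · have : extendZeroₗ K m N (Pi.single ⟨x, hx⟩ 1) = Pi.single x 1 := by
            funext y
            change extendZero N _ y = _
            by_cases hy : (y : ℕ) < m
            · rw [extendZero_of_lt _ hy, Pi.single_apply, Pi.single_apply]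
              simp [Fin.ext_iff]
            · rw [extendZero_of_le _ (not_lt.1 hy), Pi.single_eq_of_ne]
              rintro rfl; exact hy hx
          rw [← this, hΦ, sub_self]
          exact zero_mem _
        · have h1 : Q x + extendZeroₗ K m N (-(w x)) =
              Pi.single x 1 - extendZeroₗ K m N (Φ (Pi.single x 1)) := by
            simp only [hQ, dif_neg hx, hr, map_sub, map_neg]
            abel
          rw [← h1]
          exact add_mem (row_mem_rowSpace Q x) (hιmem _ (neg_mem (hw x)))
      intro v hv
      have := add_mem (key v) (hιmem _ hv)
      rwa [sub_add_cancel] at this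
  · ext1 i j
    rw [Matrix.submatrix_apply, q1 _ _ i.2 j.2]
    rfl

/-- The same for a matrix with this preimage as its row space. -/
theorem exists_popov_of_rowSpace_eq_comap (h : m ≤ N) {s : Fin m → ℤ}
    {A : Matrix (Fin m) (Fin m) K[X]} (hA : A.det ≠ 0) {B : Matrix (Fin N) (Fin N) K[X]}
    {u : Fin N → ℤ} (hu : ∀ i, u (Fin.castLE h i) = s i)
    (hu' : ∀ x : Fin N, m ≤ x → ∀ k, A.det.natDegree + s k ≤ u x)
    (Φ : (Fin N → K[X]) →ₗ[K[X]] (Fin m → K[X])) (hΦ : ∀ p, Φ (extendZeroₗ K m N p) = p)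
    (hB : rowSpace B = (rowSpace A).comap Φ) :
    B.det ≠ 0 ∧ ∃ P : Matrix (Fin N) (Fin N) K[X],
      (∀ Q, IsPopovFormOf u B Q ↔ Q = P) ∧
      (∀ Q, IsPopovFormOf s A Q ↔ Q = P.submatrix (Fin.castLE h) (Fin.castLE h)) := by
  have hdet : B.det ≠ 0 := det_ne_zero_of_smul_mem_rowSpace hA fun j => by
    rw [hB, Submodule.mem_comap, map_smul]
    exact det_smul_mem_rowSpace A _
  obtain ⟨P, hP, hPA, hdeg⟩ := exists_popovShape s hA (det_smul_mem_rowSpace A)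
  obtain ⟨Q, hQ, hQP, rfl⟩ := exists_popovShape_comap h hP hu (fun x hx k => by
    have := hu' x hx k
    have := hdeg k
    omega) Φ hΦ
  exact ⟨hdet, Q, isPopovFormOf_iff_eq hdet hQ (by rw [hQP, hPA, hB]),
    isPopovFormOf_iff_eq hA hP hPA⟩

end Block

end PolyMat

namespace PolyMat

/-! ### Digits in base `X ^ e`. -/

section Digits

variable {K : Type*} [Field K]

/-- The digit of index `l` of a polynomial in base `X ^ e`. -/
noncomputable def digit (e l : ℕ) (a : K[X]) : K[X] :=
  ∑ k ∈ Finset.range e, C (a.coeff (l * e + k)) * X ^ k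

/-- The quotient of `a` by `X ^ n`. -/
noncomputable def shiftDown (n : ℕ) (a : K[X]) : K[X] := divX^[n] a

theorem coeff_shiftDown (n : ℕ) (a : K[X]) (k : ℕ) : (shiftDown n a).coeff k = a.coeff (n + k) := by
  unfold shiftDown
  induction n generalizing a with
  | zero => simp
  | succ n ih => rw [Function.iterate_succ_apply, ih, coeff_divX]; congr 1; omega

theorem shiftDown_zero (a : K[X]) : shiftDown 0 a = a := rfl

theorem shiftDown_eq_zero {n : ℕ} {a : K[X]} (h : a.natDegree < n) : shiftDown n a = 0 := by
  ext k
  rw [coeff_shiftDown, coeff_zero]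
  exact coeff_eq_zero_of_natDegree_lt (by omega)

theorem coeff_digit (e l : ℕ) (a : K[X]) (n : ℕ) :
    (digit e l a).coeff n = if n < e then a.coeff (l * e + n) else 0 := by
  simp [digit, finsetSum_coeff, coeff_X_pow]

/-- One Horner step; the chains of extra rows implement it. -/
theorem digit_add_shiftDown (e l : ℕ) (a : K[X]) :
    digit e l a + X ^ e * shiftDown ((l + 1) * e) a = shiftDown (l * e) a := by
  ext n
  rw [coeff_add, coeff_digit, coeff_X_pow_mul', coeff_shiftDown, coeff_shiftDown]
  split_ifs with h1 h2 h2
  · omega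
  · simp
  · rw [zero_add]; congr 1; rw [add_mul]; omega
  · omega

theorem sum_digit_add_shiftDown (e N : ℕ) (a : K[X]) :
    digit e 0 a + ∑ f ∈ Finset.range N, digit e (f + 1) a * X ^ (e * (f + 1)) +
      X ^ (e * (N + 1)) * shiftDown ((N + 1) * e) a = a := by
  induction N with
  | zero => simpa [shiftDown_zero] using digit_add_shiftDown e 0 a
  | succ N ih =>
    conv_rhs => rw [← ih]
    rw [Finset.sum_range_succ, ← digit_add_shiftDown e (N + 1) a]
    ring

theorem sum_digit {e N : ℕ} {a : K[X]} (h : a.natDegree < (N + 1) * e) :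
    digit e 0 a + ∑ f ∈ Finset.range N, digit e (f + 1) a * X ^ (e * (f + 1)) = a := by
  have := sum_digit_add_shiftDown e N a
  rwa [shiftDown_eq_zero h, mul_zero, add_zero] at this

theorem natDegree_digit_lt {e : ℕ} (he : 0 < e) (l : ℕ) (a : K[X]) :
    (digit e l a).natDegree < e := by
  by_contra! h
  have h0 : (digit e l a).natDegree ≠ 0 := by omega
  have : digit e l a ≠ 0 := by rintro h; simp [h] at h0
  refine leadingCoeff_ne_zero.2 this ?_
  rw [leadingCoeff, coeff_digit, if_neg (by omega)]

end Digits

/-! ### Indexing the rows and columns, the original ones first. -/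

section Labels

/-- The labels of the rows and columns of a partial linearization: `(0, i, 0)` is the row or column
`i` of the original matrix, `(1, i, k)` is the row of the digits of index `k` of the row `i`, and
`(2, j, k)` is the column of the digits of index `k` of the `j`-th pivot column. -/
def labels (m : ℕ) (α : ℕ → ℕ) : List (ℕ × ℕ × ℕ) :=
  (List.range m).map (fun i => (0, i, 0)) ++
    ((List.range m).flatMap (fun i => (List.range (α i)).map fun k => (1, i, k + 1)) ++
      (List.range m).flatMap (fun i => (List.range (α i)).map fun k => (2, i, k + 1)))

variable {m : ℕ} {α : ℕ → ℕ}

theorem nodup_labels : (labels m α).Nodup := by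
  have (t : ℕ) : ((List.range m).flatMap
      (fun i => (List.range (α i)).map fun k => (t, i, k + 1))).Nodup := by
    rw [List.nodup_flatMap]
    refine ⟨fun i _ => List.nodup_range.map fun _ _ h => by simpa using h, ?_⟩
    refine List.nodup_range.imp fun {i j} hij => ?_
    simp only [Function.onFun, List.disjoint_left, List.mem_map]
    rintro _ ⟨k, -, rfl⟩ ⟨l, -, h⟩
    simp_all
  unfold labels
  refine List.nodup_append.2 ⟨List.nodup_range.map fun _ _ h => by simpa using h,
    List.nodup_append.2 ⟨this 1, this 2, ?_⟩, ?_⟩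
  · simp only [List.mem_flatMap, List.mem_map]
    rintro _ ⟨i, -, k, -, rfl⟩ _ ⟨j, -, l, -, rfl⟩
    simp
  · simp only [List.mem_append, List.mem_flatMap, List.mem_map]
    rintro _ ⟨i, -, rfl⟩ _ (⟨j, -, l, -, rfl⟩ | ⟨j, -, l, -, rfl⟩) <;> simp

theorem sum_labels {V : Type*} [AddCommMonoid V] (g : ℕ × ℕ × ℕ → V) :
    ∑ y : Fin (labels m α).length, g ((labels m α).get y) =
      ∑ i ∈ Finset.range m, g (0, i, 0) +
        (∑ i ∈ Finset.range m, ∑ k ∈ Finset.range (α i), g (1, i, k + 1) +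
          ∑ i ∈ Finset.range m, ∑ k ∈ Finset.range (α i), g (2, i, k + 1)) := by
  have hr (n : ℕ) (f : ℕ → V) : ((List.range n).map f).sum = ∑ i ∈ Finset.range n, f i := rfl
  have : ∑ y : Fin (labels m α).length, g ((labels m α).get y) = ((labels m α).map g).sum := by
    rw [← List.sum_ofFn]; simp
  rw [this]
  simp [labels, List.flatMap_def, List.sum_flatten, List.map_map,
    Function.comp_def, hr]

theorem length_labels :
    (labels m α).length = m + (∑ i ∈ Finset.range m, α i + ∑ i ∈ Finset.range m, α i) := by
  simpa using sum_labels (m := m) (α := α) (fun _ => (1 : ℕ))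

theorem labels_get_of_lt {x : Fin (labels m α).length} (hx : (x : ℕ) < m) :
    (labels m α).get x = (0, (x : ℕ), 0) := by
  have : (labels m α)[(x : ℕ)] = _ := List.getElem_append_left (by simpa using hx)
  rw [List.get_eq_getElem, this]
  simp

theorem labels_get_of_le {x : Fin (labels m α).length} (hx : m ≤ (x : ℕ)) :
    (∃ i < m, ∃ k < α i, (labels m α).get x = (1, i, k + 1)) ∨
      ∃ i < m, ∃ k < α i, (labels m α).get x = (2, i, k + 1) := by
  have h : (labels m α).get x ∈ labels m α := List.get_mem _ _
  have h2 : (labels m α).get x ∈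
      ((List.range m).flatMap (fun i => (List.range (α i)).map fun k => (1, i, k + 1)) ++
      (List.range m).flatMap (fun i => (List.range (α i)).map fun k => (2, i, k + 1))) := by
    have : (labels m α)[(x : ℕ)] = _ := List.getElem_append_right (by simpa using hx)
    rw [List.get_eq_getElem, this]
    exact List.getElem_mem _
  simp only [List.mem_append, List.mem_flatMap, List.mem_map, List.mem_range] at h2
  rcases h2 with ⟨i, hi, k, hk, h⟩ | ⟨i, hi, k, hk, h⟩
  · exact Or.inl ⟨i, hi, k, hk, h.symm⟩
  · exact Or.inr ⟨i, hi, k, hk, h.symm⟩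

end Labels

end PolyMat

namespace PolyMat

/-! ### The partial linearization and its collapse onto `A`. -/

section Linearization

variable {K : Type*} [Field K]

/-- The entries of the partial linearization of the matrix of entries `a i j`, in base `X ^ e`. The
rows `i` of the entries `a i j` with `rt i j` are expanded, and for the other entries the columns,
the column `p k` being expanded into columns of labels `(2, k, _)`. -/
noncomputable def linEntry (e : ℕ) (a : ℕ → ℕ → K[X]) (rt : ℕ → ℕ → Prop)
    [∀ i j, Decidable (rt i j)] (p : ℕ → ℕ) (x y : ℕ × ℕ × ℕ) : K[X] :=
  if x.1 = 2 then
    if y.1 = 2 then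
      (if x.2.1 = y.2.1 ∧ y.2.2 = x.2.2 then 1 else 0) -
        (if x.2.1 = y.2.1 ∧ x.2.2 = y.2.2 + 1 then X ^ e else 0)
    else if y.1 = 0 ∧ y.2.1 = p x.2.1 ∧ x.2.2 = 1 then -X ^ e else 0
  else if y.1 = 2 then
    if x.2.2 = 0 ∧ ¬ rt x.2.1 (p y.2.1) then digit e y.2.2 (a x.2.1 (p y.2.1)) else 0
  else if y.1 = 1 then
    (if x.2.1 = y.2.1 ∧ y.2.2 = x.2.2 + 1 then X ^ e else 0) -
      (if x.2.1 = y.2.1 ∧ y.2.2 = x.2.2 then 1 else 0)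
  else if x.2.2 = 0 ∨ rt x.2.1 y.2.1 then digit e x.2.2 (a x.2.1 y.2.1) else 0

variable {m e : ℕ} {α : ℕ → ℕ} {a : ℕ → ℕ → K[X]} {rt : ℕ → ℕ → Prop}
  [∀ i j, Decidable (rt i j)] {p : ℕ → ℕ} {V : Type*} [AddCommGroup V] [Module K[X] V]

/-- The values of `g` lie in an arbitrary module because the formula is needed twice: for the images
under the collapse and for the kernel generators `E` in `rowSpace_linMatrix`. -/
theorem sum_linEntry_colRow (g : ℕ × ℕ × ℕ → V) {k f : ℕ} (hk : k < m) (hf : f < α k)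
    (hp : p k < m) :
    ∑ y : Fin (labels m α).length,
        linEntry e a rt p (2, k, f + 1) ((labels m α).get y) • g ((labels m α).get y) =
      g (2, k, f + 1) - (X ^ e : K[X]) • (if f = 0 then g (0, p k, 0) else g (2, k, f)) := by
  rw [sum_labels (fun y => linEntry e a rt p (2, k, f + 1) y • g y)]
  have h2 : ∑ i ∈ Finset.range m, ∑ l ∈ Finset.range (α i),
      linEntry e a rt p (2, k, f + 1) (2, i, l + 1) • g (2, i, l + 1) =
      g (2, k, f + 1) - (X ^ e : K[X]) • (if f = 0 then 0 else g (2, k, f)) := by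
    rw [Finset.sum_eq_single k]
    · simp only [linEntry, if_true, true_and, sub_smul, Finset.sum_sub_distrib, add_left_inj,
        ite_smul, one_smul, zero_smul, Finset.sum_ite_eq', Finset.mem_range, hf]
      congr 1
      rcases f with _ | f
      · simp
      · rw [Finset.sum_eq_single f]
        · simp
        · intro l _ hl; rw [if_neg (by omega)]
        · intro h; exact absurd (Finset.mem_range.2 (by omega)) h
    · intro i _ hi
      refine Finset.sum_eq_zero fun l _ => ?_
      simp [linEntry, hi.symm]
    · intro h; exact absurd (Finset.mem_range.2 hk) h
  have h0 : ∑ i ∈ Finset.range m, linEntry e a rt p (2, k, f + 1) (0, i, 0) • g (0, i, 0) =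
      if f = 0 then -((X ^ e : K[X]) • g (0, p k, 0)) else 0 := by
    by_cases hf0 : f = 0
    · subst hf0
      rw [Finset.sum_eq_single (p k)]
      · simp [linEntry]
      · intro i _ hi; simp [linEntry, hi]
      · intro h; exact absurd (Finset.mem_range.2 hp) h
    · simp [linEntry, hf0]
  rw [h0, h2]
  have h1 : ∑ i ∈ Finset.range m, ∑ l ∈ Finset.range (α i),
      linEntry e a rt p (2, k, f + 1) (1, i, l + 1) • g (1, i, l + 1) = 0 := by
    simp [linEntry]
  rw [h1]
  split_ifs <;> simp [sub_eq_add_neg, add_comm]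

/-- Common to base rows (`d = 0`, where the `-1` is absent) and digit rows. -/
theorem sum_linEntry_rowPart (g : ℕ × ℕ × ℕ → V) {i d : ℕ} (hi : i < m) :
    ∑ i' ∈ Finset.range m, ∑ l ∈ Finset.range (α i'),
      ((if i = i' ∧ l + 1 = d + 1 then (X ^ e : K[X]) else 0) -
        (if i = i' ∧ l + 1 = d then 1 else 0)) • g (1, i', l + 1) =
      (X ^ e : K[X]) • (if d < α i then g (1, i, d + 1) else 0) -
        (if d ≠ 0 ∧ d ≤ α i then g (1, i, d) else 0) := by
  rw [Finset.sum_eq_single i]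
  · simp only [true_and, sub_smul, Finset.sum_sub_distrib, add_left_inj,
      ite_smul, one_smul, zero_smul, Finset.sum_ite_eq', Finset.mem_range]
    congr 1
    · split_ifs <;> simp
    · rcases d with _ | d
      · simp
      · simp only [add_left_inj, Finset.sum_ite_eq', Finset.mem_range]
        simp
  · intro i' _ hi'
    refine Finset.sum_eq_zero fun l _ => ?_
    simp [hi'.symm]
  · intro h; exact absurd (Finset.mem_range.2 hi) h

theorem sum_linEntry_digitRow (g : ℕ × ℕ × ℕ → V) {i d : ℕ} (hi : i < m) (hd : d < α i) :
    ∑ y : Fin (labels m α).length,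
        linEntry e a rt p (1, i, d + 1) ((labels m α).get y) • g ((labels m α).get y) =
      ∑ j ∈ Finset.range m, (if rt i j then digit e (d + 1) (a i j) else 0) • g (0, j, 0) +
        ((X ^ e : K[X]) • (if d + 1 < α i then g (1, i, d + 2) else 0) - g (1, i, d + 1)) := by
  rw [sum_labels (fun y => linEntry e a rt p (1, i, d + 1) y • g y)]
  have h1 := sum_linEntry_rowPart (K := K) (α := α) (e := e) g (d := d + 1) hi
  rw [if_pos (⟨Nat.succ_ne_zero d, hd⟩ : d + 1 ≠ 0 ∧ d + 1 ≤ α i)] at h1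
  rw [← h1]
  simp [linEntry]

theorem sum_linEntry_baseRow (g : ℕ × ℕ × ℕ → V) {i : ℕ} (hi : i < m) :
    ∑ y : Fin (labels m α).length,
        linEntry e a rt p (0, i, 0) ((labels m α).get y) • g ((labels m α).get y) =
      ∑ j ∈ Finset.range m, digit e 0 (a i j) • g (0, j, 0) +
        ((X ^ e : K[X]) • (if 0 < α i then g (1, i, 1) else 0) +
        ∑ k ∈ Finset.range m, ∑ f ∈ Finset.range (α k),
          (if ¬ rt i (p k) then digit e (f + 1) (a i (p k)) else 0) • g (2, k, f + 1)) := by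
  rw [sum_labels (fun y => linEntry e a rt p (0, i, 0) y • g y)]
  have h1 := sum_linEntry_rowPart (K := K) (α := α) (e := e) g (d := 0) hi
  rw [if_neg (by simp : ¬ (0 ≠ 0 ∧ 0 ≤ α i)), sub_zero] at h1
  simp only [zero_add] at h1
  rw [← h1]
  simp [linEntry]

/-- The image of the unit vector with a given label under the map which collapses the partial
linearization. -/
noncomputable def collapse (m e : ℕ) (a : ℕ → ℕ → K[X]) (rt : ℕ → ℕ → Prop)
    [∀ i j, Decidable (rt i j)] (p : ℕ → ℕ) (l : ℕ × ℕ × ℕ) : Fin m → K[X] := fun j =>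
  if l.1 = 0 then if (j : ℕ) = l.2.1 then 1 else 0
  else if l.1 = 1 then if rt l.2.1 j then shiftDown (l.2.2 * e) (a l.2.1 j) else 0
  else if (j : ℕ) = p l.2.1 then X ^ (e * l.2.2) else 0

theorem sum_collapse_base (c : ℕ → K[X]) (j : Fin m) :
    (∑ i ∈ Finset.range m, c i • collapse m e a rt p (0, i, 0)) j = c j := by
  simp [collapse, Finset.sum_apply]

/-- The map which collapses the partial linearization. -/
noncomputable def collapseₗ (m e : ℕ) (α : ℕ → ℕ) (a : ℕ → ℕ → K[X]) (rt : ℕ → ℕ → Prop)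
    [∀ i j, Decidable (rt i j)] (p : ℕ → ℕ) :
    (Fin (labels m α).length → K[X]) →ₗ[K[X]] (Fin m → K[X]) :=
  Fintype.linearCombination K[X] fun y => collapse m e a rt p ((labels m α).get y)

theorem collapseₗ_apply (v : Fin (labels m α).length → K[X]) :
    collapseₗ m e α a rt p v = ∑ y, v y • collapse m e a rt p ((labels m α).get y) := rfl

theorem collapseₗ_colRow {k f : ℕ} (hk : k < m) (hf : f < α k) (hp : p k < m) :
    collapseₗ m e α a rt p
      (fun y => linEntry e a rt p (2, k, f + 1) ((labels m α).get y)) = 0 := by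
  rw [collapseₗ_apply, sum_linEntry_colRow _ hk hf hp, sub_eq_zero]
  funext j
  rcases f with _ | f
  · simp [collapse]
  · simp only [collapse, Pi.smul_apply, smul_eq_mul]
    rw [if_neg (Nat.succ_ne_zero f)]
    by_cases hj : (j : ℕ) = p k
    · simp [collapse, hj]; ring
    · simp [collapse, hj]

/-- The row reads: digit, plus `X ^ e` times the next quotient, minus the current quotient. -/
theorem collapseₗ_digitRow {i d : ℕ} (hi : i < m) (hd : d < α i)
    (h : ∀ j < m, rt i j → (a i j).natDegree < (α i + 1) * e) :
    collapseₗ m e α a rt p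
      (fun y => linEntry e a rt p (1, i, d + 1) ((labels m α).get y)) = 0 := by
  rw [collapseₗ_apply, sum_linEntry_digitRow _ hi hd]
  funext j
  rw [Pi.add_apply, sum_collapse_base]
  have h1 : (if d + 1 < α i then collapse m e a rt p (1, i, d + 2) else 0) j =
      if rt i j then shiftDown ((d + 2) * e) (a i j) else 0 := by
    by_cases hd' : d + 1 < α i
    · rw [if_pos hd']; simp [collapse]
    · have : d + 1 = α i := by omega
      -- At the end of the chain there is no further column, consistently with the next quotient
      -- being zero by the degree bound.
      rw [if_neg hd', Pi.zero_apply]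
      split_ifs with hr
      · rw [shiftDown_eq_zero]
        rw [show d + 2 = α i + 1 by omega]
        exact h j j.2 hr
      · rfl
  rw [Pi.sub_apply, Pi.smul_apply, h1]
  simp only [collapse, one_ne_zero, if_false, if_true]
  split_ifs with hr
  · rw [← digit_add_shiftDown e (d + 1)]
    simp
  · simp

/-- Entries expanded by row are recovered by one Horner step, entries expanded by column from their
full digit expansion. `hp` makes each column the pivot column of exactly one row. -/
theorem collapseₗ_baseRow {i : ℕ} (hi : i < m)
    (h1 : ∀ j < m, rt i j → (a i j).natDegree < (α i + 1) * e)
    (h2 : ∀ k < m, ¬ rt i (p k) → (a i (p k)).natDegree < (α k + 1) * e)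
    (hp : ∀ j < m, ∃ k < m, ∀ k' < m, p k' = j ↔ k' = k) :
    collapseₗ m e α a rt p (fun y => linEntry e a rt p (0, i, 0) ((labels m α).get y)) =
      fun j : Fin m => a i j := by
  rw [collapseₗ_apply, sum_linEntry_baseRow _ hi]
  funext j
  rw [Pi.add_apply, sum_collapse_base]
  have hrow : (if 0 < α i then collapse m e a rt p (1, i, 1) else 0) j =
      if rt i j then shiftDown (1 * e) (a i j) else 0 := by
    by_cases hd' : 0 < α i
    · rw [if_pos hd']; simp [collapse]
    · rw [if_neg hd', Pi.zero_apply]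
      split_ifs with hr
      · rw [shiftDown_eq_zero]
        have := h1 j j.2 hr
        rwa [show α i = 0 by omega] at this
      · rfl
  obtain ⟨k, hk, hkj⟩ := hp j j.2
  have hcol : (∑ k ∈ Finset.range m, ∑ f ∈ Finset.range (α k),
      (if ¬ rt i (p k) then digit e (f + 1) (a i (p k)) else 0) •
        collapse m e a rt p (2, k, f + 1)) j =
      if rt i j then 0 else
        ∑ f ∈ Finset.range (α k), digit e (f + 1) (a i j) * X ^ (e * (f + 1)) := by
    rw [Finset.sum_apply, Finset.sum_eq_single k]
    · rw [Finset.sum_apply]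
      have : p k = j := (hkj k hk).2 rfl
      rw [this]
      split_ifs with hr
      · simp
      · refine Finset.sum_congr rfl fun f _ => ?_
        simp [collapse, this]
    · intro k' hk' hne
      rw [Finset.sum_apply]
      refine Finset.sum_eq_zero fun f _ => ?_
      have : ¬ (j : ℕ) = p k' := fun h => hne ((hkj k' (Finset.mem_range.1 hk')).1 h.symm)
      simp [collapse, this]
    · intro h; exact absurd (Finset.mem_range.2 hk) h
  rw [Pi.add_apply, hcol, Pi.smul_apply, hrow]
  have hpk : p k = j := (hkj k hk).2 rfl
  split_ifs with hr
  · have := digit_add_shiftDown e 0 (a i j)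
    rw [zero_mul, zero_add, shiftDown_zero] at this
    simpa using this
  · rw [smul_zero, zero_add]
    exact sum_digit (by have := h2 k hk; rw [hpk] at this; exact this hr)

/-- The partial linearization. -/
noncomputable def linMatrix (m e : ℕ) (α : ℕ → ℕ) (a : ℕ → ℕ → K[X]) (rt : ℕ → ℕ → Prop)
    [∀ i j, Decidable (rt i j)] (p : ℕ → ℕ) :
    Matrix (Fin (labels m α).length) (Fin (labels m α).length) K[X] :=
  fun x y => linEntry e a rt p ((labels m α).get x) ((labels m α).get y)

theorem le_length_labels : m ≤ (labels m α).length := by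
  rw [length_labels]; omega

theorem exists_get_labels {l : ℕ × ℕ × ℕ} (hl : l ∈ labels m α) :
    ∃ x, (labels m α).get x = l := List.mem_iff_get.1 hl

theorem collapseₗ_extendZero (q : Fin m → K[X]) :
    collapseₗ m e α a rt p (extendZeroₗ K m (labels m α).length q) = q := by
  have h : ∀ y : Fin (labels m α).length, extendZero (labels m α).length q y =
      (fun l : ℕ × ℕ × ℕ => if h : l.1 = 0 ∧ l.2.1 < m then q ⟨l.2.1, h.2⟩ else 0)
        ((labels m α).get y) := by
    intro y
    by_cases hy : (y : ℕ) < m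
    · rw [extendZero_of_lt _ hy, labels_get_of_lt hy]
      simp [hy]
    · rw [extendZero_of_le _ (not_lt.1 hy)]
      rcases labels_get_of_le (not_lt.1 hy) with ⟨i, hi, k, hk, h⟩ | ⟨i, hi, k, hk, h⟩ <;>
        · rw [h]; rfl
  rw [collapseₗ_apply]
  have h' : ∀ y, extendZeroₗ K m (labels m α).length q y = _ := h
  simp only [h']
  rw [sum_labels (fun l => (if h : l.1 = 0 ∧ l.2.1 < m then q ⟨l.2.1, h.2⟩ else 0) •
    collapse m e a rt p l)]
  simp only [one_ne_zero, OfNat.ofNat_ne_zero, false_and, dite_false, zero_smul,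
    Finset.sum_const_zero, add_zero, true_and]
  funext j
  rw [sum_collapse_base (fun i => if h : i < m then q ⟨i, h⟩ else 0)]
  simp

/-- `Φ` maps the rows of `B` to rows of `A` or to zero. Conversely, it is enough that the row space
of `B` contains `v - ι (Φ v)` for all `v`: this gives the kernel of `Φ`, and then, from the base
rows, the extended rows of `A`. -/
theorem rowSpace_linMatrix {A : Matrix (Fin m) (Fin m) K[X]} (ha : ∀ i j : Fin m, a i j = A i j)
    (h1 : ∀ i < m, ∀ j < m, rt i j → (a i j).natDegree < (α i + 1) * e)
    (h2 : ∀ i < m, ∀ k < m, ¬ rt i (p k) → (a i (p k)).natDegree < (α k + 1) * e)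
    (hpm : ∀ k < m, p k < m)
    (hp : ∀ j < m, ∃ k < m, ∀ k' < m, p k' = j ↔ k' = k) :
    rowSpace (linMatrix m e α a rt p) = (rowSpace A).comap (collapseₗ m e α a rt p) := by
  classical
  set Φ := collapseₗ m e α a rt p with hΦ
  set ι := extendZeroₗ K m (labels m α).length with hι
  set B := linMatrix m e α a rt p with hB
  have hΦι : ∀ q, Φ (ι q) = q := collapseₗ_extendZero
  have hbase (x : Fin (labels m α).length) (hx : (x : ℕ) < m) : Φ (B x) = A ⟨x, hx⟩ := by
    have := collapseₗ_baseRow hx (h1 x hx) (h2 x hx) hp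
    rw [← labels_get_of_lt hx] at this
    refine this.trans (funext fun j => ha ⟨x, hx⟩ j)
  have hextra (x : Fin (labels m α).length) (hx : m ≤ (x : ℕ)) : Φ (B x) = 0 := by
    rcases labels_get_of_le hx with ⟨i, hi, k, hk, h⟩ | ⟨i, hi, k, hk, h⟩
    · have := collapseₗ_digitRow (p := p) hi hk (h1 i hi)
      rwa [← h] at this
    · have := collapseₗ_colRow (e := e) (a := a) (rt := rt) hi hk (hpm i hi)
      rwa [← h] at this
  -- The defects of the unit vectors; they generate the kernel of `Φ`.
  set E : ℕ × ℕ × ℕ → Fin (labels m α).length → K[X] := fun l =>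
    (fun y => if (labels m α).get y = l then 1 else 0) - ι (collapse m e a rt p l) with hE
  have hEget (x) : Pi.single x 1 - ι (Φ (Pi.single x 1)) = E ((labels m α).get x) := by
    simp only [hE]
    congr 1
    · funext y
      rw [Pi.single_apply]
      simp only [nodup_labels.get_inj_iff]
    · rw [hΦ, collapseₗ_apply]
      simp [Pi.single_apply]
  have hdefect (v : Fin (labels m α).length → K[X]) :
      v - ι (Φ v) = ∑ y, v y • E ((labels m α).get y) := by
    have hv : v = ∑ y, v y • (Pi.single y 1 : Fin (labels m α).length → K[X]) := by
      conv_lhs => rw [← Finset.univ_sum_single v]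
      exact Finset.sum_congr rfl fun x _ => by rw [← Pi.single_smul, smul_eq_mul, mul_one]
    simp only [← hEget, smul_sub, Finset.sum_sub_distrib]
    rw [← hv]
    congr 1
    conv_lhs => rw [hv]
    simp only [map_sum, map_smul]
  have hE0 (j : ℕ) (hj : j < m) : E (0, j, 0) = 0 := by
    have hjN : j < (labels m α).length := hj.trans_le le_length_labels
    have := labels_get_of_lt (α := α) (x := ⟨j, hjN⟩) hj
    have h3 : (Pi.single ⟨j, hjN⟩ 1 : Fin (labels m α).length → K[X]) =
        ι (Pi.single ⟨j, hj⟩ 1) := by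
      funext y
      change _ = extendZero _ _ y
      by_cases hy : (y : ℕ) < m
      · rw [extendZero_of_lt _ hy, Pi.single_apply, Pi.single_apply]
        simp [Fin.ext_iff]
      · rw [extendZero_of_le _ (not_lt.1 hy), Pi.single_eq_of_ne]
        rintro rfl; exact hy hj
    rw [← this, ← hEget, h3, hΦι, sub_self]
  -- A column chain is solved upwards: its first row is already `E (2, k, 1)`, as the defects of
  -- base labels vanish.
  have hcol (k) (hk : k < m) : ∀ f < α k, E (2, k, f + 1) ∈ rowSpace B := by
    intro f
    induction f with
    | zero =>
      intro hf
      obtain ⟨x, hx⟩ := exists_get_labels (m := m) (α := α) (l := (2, k, 0 + 1)) (by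
        simp [labels, hk, hf])
      have h3 := hdefect (B x)
      have h4 : ¬ (x : ℕ) < m := fun h => by rw [labels_get_of_lt h] at hx; simp at hx
      rw [hextra x (not_lt.1 h4), map_zero, sub_zero] at h3
      simp only [hB, linMatrix, hx] at h3
      rw [sum_linEntry_colRow _ hk hf (hpm k hk), if_pos rfl, hE0 _ (hpm k hk), smul_zero,
        sub_zero] at h3
      rw [← h3]
      exact row_mem_rowSpace B x
    | succ f ih =>
      intro hf
      obtain ⟨x, hx⟩ := exists_get_labels (m := m) (α := α) (l := (2, k, f + 1 + 1)) (by
        simp [labels, hk, hf])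
      have h3 := hdefect (B x)
      have h4 : ¬ (x : ℕ) < m := fun h => by rw [labels_get_of_lt h] at hx; simp at hx
      rw [hextra x (not_lt.1 h4), map_zero, sub_zero] at h3
      simp only [hB, linMatrix, hx] at h3
      rw [sum_linEntry_colRow _ hk hf (hpm k hk), if_neg (Nat.succ_ne_zero f)] at h3
      have h6 : E (2, k, f + 1 + 1) = B x + (X ^ e : K[X]) • E (2, k, f + 1) := by
        rw [← sub_eq_iff_eq_add, ← h3]
      rw [h6]
      exact add_mem (row_mem_rowSpace B x) (Submodule.smul_mem _ _ (ih (by omega)))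
  -- A row chain is solved downwards from its last label, `r` bounding the distance to the end.
  have hrow (i) (hi : i < m) : ∀ r d, d < α i → α i ≤ d + r → E (1, i, d + 1) ∈ rowSpace B := by
    intro r
    induction r with
    | zero => intro d h h'; omega
    | succ r ih =>
      intro d hd hr
      obtain ⟨x, hx⟩ := exists_get_labels (m := m) (α := α) (l := (1, i, d + 1)) (by
        simp [labels, hi, hd])
      have h3 := hdefect (B x)
      have h4 : ¬ (x : ℕ) < m := fun h => by rw [labels_get_of_lt h] at hx; simp at hx
      rw [hextra x (not_lt.1 h4), map_zero, sub_zero] at h3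
      have h5 : ∑ y, B x y • E ((labels m α).get y) =
          (X ^ e : K[X]) • (if d + 1 < α i then E (1, i, d + 2) else 0) - E (1, i, d + 1) := by
        simp only [hB, linMatrix, hx]
        rw [sum_linEntry_digitRow _ hi hd, Finset.sum_eq_zero, zero_add]
        intro j hj
        rw [hE0 j (Finset.mem_range.1 hj), smul_zero]
      rw [h5] at h3
      have h6 : E (1, i, d + 1) =
          (X ^ e : K[X]) • (if d + 1 < α i then E (1, i, d + 2) else 0) - B x := by
        rw [h3]; abel
      rw [h6]
      refine sub_mem (Submodule.smul_mem _ _ ?_) (row_mem_rowSpace B x)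
      split_ifs with h7
      · exact ih (d + 1) h7 (by omega)
      · exact zero_mem _
  have hEmem (x) : E ((labels m α).get x) ∈ rowSpace B := by
    by_cases hx : (x : ℕ) < m
    · rw [labels_get_of_lt hx, hE0 _ hx]; exact zero_mem _
    · rcases labels_get_of_le (not_lt.1 hx) with ⟨i, hi, k, hk, h⟩ | ⟨i, hi, k, hk, h⟩
      · rw [h]; exact hrow i hi (α i) k hk (by omega)
      · rw [h]; exact hcol i hi k hk
  have hdmem (v) : v - ι (Φ v) ∈ rowSpace B := by
    rw [hdefect]
    exact sum_mem fun y _ => Submodule.smul_mem _ _ (hEmem y)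
  have hιmem (q) (hq : q ∈ rowSpace A) : ι q ∈ rowSpace B := by
    obtain ⟨c, rfl⟩ := mem_rowSpace_iff.1 hq
    rw [map_sum]
    refine sum_mem fun i _ => ?_
    rw [map_smul]
    refine Submodule.smul_mem _ _ ?_
    have h3 := hdmem (B (Fin.castLE le_length_labels i))
    rw [hbase _ i.2] at h3
    simpa using sub_mem (row_mem_rowSpace B (Fin.castLE le_length_labels i)) h3
  apply le_antisymm
  · refine Submodule.span_le.2 ?_
    rintro _ ⟨x, rfl⟩
    change Φ (B x) ∈ rowSpace A
    by_cases hx : (x : ℕ) < m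
    · rw [hbase x hx]; exact row_mem_rowSpace A _
    · rw [hextra x (not_lt.1 hx)]; exact zero_mem _
  · intro v hv
    simpa using add_mem (hdmem v) (hιmem _ hv)

end Linearization

end PolyMat

namespace PolyMat

/-! ### Choice of pivots and the construction read off the degree table. -/

section Plan

/-- The entry of a table, `0` out of range. -/
def tableEntry (T : List (List ℕ)) (i j : ℕ) : ℕ := (T.getD i []).getD j 0

/-- `p` is a permutation such that no entry of the table exceeds both the pivot `(i, p i)` of its
row and the pivot of its column. -/
def IsDominant (T : List (List ℕ)) (p : List ℕ) : Prop :=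
  ∀ i < T.length, p.getD i 0 < T.length ∧ ∀ k < T.length,
    (p.getD i 0 = p.getD k 0 → i = k) ∧
    tableEntry T i (p.getD k 0) ≤ max (tableEntry T i (p.getD i 0)) (tableEntry T k (p.getD k 0))

/-- Maximize `∑ 2 ^ degree`. An entry exceeding both pivots could be swapped in: its weight is at
least the sum of the two old weights, and the other new weight is positive. Maximizing the plain sum
of degrees would not exclude this. -/
theorem exists_isDominant (T : List (List ℕ)) : ∃ p, IsDominant T p := by
  classical
  obtain ⟨π, -, hπ⟩ := Finset.exists_max_image (Finset.univ : Finset (Equiv.Perm (Fin T.length)))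
    (fun π => ∑ i : Fin T.length, 2 ^ tableEntry T i (π i)) ⟨1, Finset.mem_univ _⟩
  refine ⟨List.ofFn fun i => (π i : ℕ), fun i hi => ?_⟩
  have hget (k) (hk : k < T.length) :
      (List.ofFn fun i => (π i : ℕ)).getD k 0 = π ⟨k, hk⟩ := by
    simp [List.getD_eq_getElem?_getD, hk]
  rw [hget i hi]
  refine ⟨(π ⟨i, hi⟩).2, fun k hk => ?_⟩
  rw [hget k hk]
  refine ⟨fun h => Fin.mk.inj_iff.1 (π.injective (Fin.ext h)), ?_⟩
  by_contra! hlt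
  set x : Fin T.length := ⟨i, hi⟩
  set y : Fin T.length := ⟨k, hk⟩
  have hne : x ≠ y := by
    rintro h
    have : tableEntry T i (π y) = tableEntry T i (π x) := by rw [h]
    rw [max_lt_iff] at hlt
    omega
  have h1 := hπ (π * Equiv.swap x y) (Finset.mem_univ _)
  have hsplit (f : Fin T.length → ℕ) :
      ∑ z, f z = f x + (f y + ∑ z ∈ (Finset.univ.erase x).erase y, f z) := by
    rw [Finset.add_sum_erase _ _ (Finset.mem_erase.2 ⟨hne.symm, Finset.mem_univ _⟩),
      Finset.add_sum_erase _ _ (Finset.mem_univ _)]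
  rw [hsplit, hsplit] at h1
  have h2 : ∑ z ∈ (Finset.univ.erase x).erase y, 2 ^ tableEntry T z ((π * Equiv.swap x y) z) =
      ∑ z ∈ (Finset.univ.erase x).erase y, 2 ^ tableEntry T z (π z) := by
    refine Finset.sum_congr rfl fun z hz => ?_
    simp only [Finset.mem_erase] at hz
    rw [Equiv.Perm.mul_apply, Equiv.swap_apply_of_ne_of_ne hz.2.1 hz.1]
  rw [h2, Equiv.Perm.mul_apply, Equiv.Perm.mul_apply, Equiv.swap_apply_left,
    Equiv.swap_apply_right] at h1
  rw [max_lt_iff] at hlt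
  have h3 : 2 ^ (tableEntry T i (π x) + 1) ≤ 2 ^ tableEntry T i (π y) :=
    Nat.pow_le_pow_right (by norm_num) hlt.1
  have h4 : 2 ^ (tableEntry T k (π y) + 1) ≤ 2 ^ tableEntry T i (π y) :=
    Nat.pow_le_pow_right (by norm_num) hlt.2
  have h5 : 0 < 2 ^ tableEntry T k (π x) := Nat.pow_pos (by norm_num)
  rw [pow_succ] at h3 h4
  change 2 ^ tableEntry T i (π y) + (2 ^ tableEntry T k (π x) + _) ≤
    2 ^ tableEntry T i (π x) + (2 ^ tableEntry T k (π y) + _) at h1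
  omega

theorem exists_code_isDominant (T : List (List ℕ)) :
    ∃ n, IsDominant T ((Encodable.decode n).getD []) := by
  obtain ⟨p, hp⟩ := exists_isDominant T
  exact ⟨Encodable.encode p, by simpa using hp⟩

instance decidableRelIsDominant :
    DecidableRel fun (T : List (List ℕ)) (n : ℕ) =>
      IsDominant T ((Encodable.decode n).getD []) := fun T n => by
  unfold IsDominant; infer_instance

/-- The columns of the pivots of a dominant permutation. -/
def pivotColumns (T : List (List ℕ)) : List ℕ :=
  (Encodable.decode (Nat.find (exists_code_isDominant T))).getD []

theorem isDominant_pivotColumns (T : List (List ℕ)) : IsDominant T (pivotColumns T) :=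
  Nat.find_spec (exists_code_isDominant T)

/-- The degree of the pivot of the row `i`. -/
def pivotDegree (T : List (List ℕ)) (p : List ℕ) (i : ℕ) : ℕ := tableEntry T i (p.getD i 0)

/-- The sum of the degrees of the pivots. -/
def pivotDegreeSum (T : List (List ℕ)) (p : List ℕ) : ℕ :=
  ((List.range T.length).map (pivotDegree T p)).sum

/-- The number of coefficients of the digits. -/
def digitLength (T : List (List ℕ)) (p : List ℕ) : ℕ := (pivotDegreeSum T p - 1) / T.length + 1

/-- The number of digits, other than the first one, of the row `i` and of its pivot column. -/
def extraCount (T : List (List ℕ)) (p : List ℕ) (i : ℕ) : ℕ := pivotDegree T p i / digitLength T p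

/-- The operands for the coefficients of a digit. -/
def digitOperand (e i j d k : ℕ) : Operand := if k < e then .coeff i j (d * e + k) else .zero

/-- The operands for the coefficients of the entries of the partial linearization. -/
def linOperand (T : List (List ℕ)) (p : List ℕ) (x y : ℕ × ℕ × ℕ) (k : ℕ) : Operand :=
  if x.1 = 2 then
    if y.1 = 2 then
      if x.2.1 = y.2.1 ∧ y.2.2 = x.2.2 ∧ k = 0 then .one
      else if x.2.1 = y.2.1 ∧ x.2.2 = y.2.2 + 1 ∧ k = digitLength T p then .negOne else .zero
    else if y.1 = 0 ∧ y.2.1 = p.getD x.2.1 0 ∧ x.2.2 = 1 ∧ k = digitLength T p then .negOne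
    else .zero
  else if y.1 = 2 then
    if x.2.2 = 0 ∧ ¬ tableEntry T x.2.1 (p.getD y.2.1 0) ≤ pivotDegree T p x.2.1 then
      digitOperand (digitLength T p) x.2.1 (p.getD y.2.1 0) y.2.2 k
    else .zero
  else if y.1 = 1 then
    if x.2.1 = y.2.1 ∧ y.2.2 = x.2.2 ∧ k = 0 then .negOne
    else if x.2.1 = y.2.1 ∧ y.2.2 = x.2.2 + 1 ∧ k = digitLength T p then .one else .zero
  else if x.2.2 = 0 ∨ tableEntry T x.2.1 y.2.1 ≤ pivotDegree T p x.2.1 then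
    digitOperand (digitLength T p) x.2.1 y.2.1 x.2.2 k
  else .zero

/-- A shift for the extra columns, which dominates the degrees of the determinant and the shift. -/
def largeShift (T : List (List ℕ)) (s : List ℤ) : ℤ :=
  Denumerable.ofNat ℤ (2 * ((T.map List.sum).sum + (s.map Encodable.encode).sum))

/-- The shift of the column with a given label. -/
def linShift (T : List (List ℕ)) (s : List ℤ) (x : ℕ × ℕ × ℕ) : ℤ :=
  if x.1 = 0 then s.getD x.2.1 0 else largeShift T s

/-- The labels of the partial linearization of a matrix with a given table of degrees. -/
def linLabels (T : List (List ℕ)) (p : List ℕ) : List (ℕ × ℕ × ℕ) :=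
  labels T.length (extraCount T p)

/-- The partial linearization relative to given pivots. -/
def linConstruction (T : List (List ℕ)) (s : List ℤ) (p : List ℕ) : Construction where
  steps := []
  dim := (linLabels T p).length
  shift := (linLabels T p).map (linShift T s)
  entries := (linLabels T p).map fun x => (linLabels T p).map fun y =>
    (List.range (digitLength T p + 1)).map (linOperand T p x y)

/-- The partial linearization. -/
def linPlan (a : List (List ℕ) × List ℤ) : Construction :=
  linConstruction a.1 a.2 (pivotColumns a.1)

/-- The encoding of `ℤ` doubles nonnegative integers, so decoding `2 * n` is the cast of `n`, in a
form that is primitive recursive at once. -/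
theorem natCast_le_largeShift (T : List (List ℕ)) (s : List ℤ) :
    largeShift T s = ((T.map List.sum).sum + (s.map Encodable.encode).sum : ℕ) := by
  unfold largeShift
  set n := (T.map List.sum).sum + (s.map Encodable.encode).sum
  have : Encodable.encode (n : ℤ) = 2 * n := rfl
  rw [← this, Denumerable.ofNat_encode]

theorem le_encode_int (z : ℤ) : z ≤ Encodable.encode z := by
  rcases z with n | n
  · have : Encodable.encode (Int.ofNat n) = 2 * n := rfl
    rw [this]; push_cast; simp only [Int.ofNat_eq_natCast]; omega
  · omega

end Plan

end PolyMat

namespace PolyMat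

/-! ### Computability of the plan. -/

section Computability

open Primrec

variable {β : Type} [Primcodable β]

theorem primrec_sum : Primrec (List.sum : List ℕ → ℕ) :=
  (list_foldr (h := fun _ x => x.1 + x.2) .id (.const 0)
    (nat_add.comp (fst.comp snd) (snd.comp snd))).of_eq fun _ => rfl

theorem primrec_tableEntry {T : β → List (List ℕ)} {i j : β → ℕ} (hT : Primrec T)
    (hi : Primrec i) (hj : Primrec j) : Primrec fun b => tableEntry (T b) (i b) (j b) :=
  (list_getD 0).comp ((list_getD []).comp hT hi) hj

theorem primrecPred_forall_lt {n : β → ℕ} (hn : Primrec n) {R : ℕ → β → Prop}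
    (hR : PrimrecRel R) : PrimrecPred fun b => ∀ x < n b, R x b := by
  exact (hR.forall_mem_list.comp (list_range.comp hn) Primrec.id).of_eq fun b => by simp

theorem primrecPred_imp {P Q : β → Prop} (hP : PrimrecPred P) (hQ : PrimrecPred Q) :
    PrimrecPred fun b => P b → Q b :=
  (hP.not.or hQ).of_eq fun _ => imp_iff_not_or.symm

theorem primrecPred_isDominant {T : β → List (List ℕ)} {p : β → List ℕ} (hT : Primrec T)
    (hp : Primrec p) : PrimrecPred fun b => IsDominant (T b) (p b) := by
  have hlen : Primrec fun b => (T b).length := list_length.comp hT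
  unfold IsDominant
  refine primrecPred_forall_lt hlen ?_
  have hT1 : Primrec fun x : ℕ × β => T x.2 := hT.comp snd
  have hp1 : Primrec fun x : ℕ × β => p x.2 := hp.comp snd
  have hpi : Primrec fun x : ℕ × β => (p x.2).getD x.1 0 := (list_getD 0).comp hp1 fst
  refine PrimrecPred.and (nat_lt.comp hpi (hlen.comp snd)) ?_
  refine primrecPred_forall_lt (n := fun x : ℕ × β => (T x.2).length) (hlen.comp snd) ?_
  have hT2 : Primrec fun x : ℕ × ℕ × β => T x.2.2 := hT1.comp snd
  have hpi2 : Primrec fun x : ℕ × ℕ × β => (p x.2.2).getD x.2.1 0 := hpi.comp snd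
  have hpk2 : Primrec fun x : ℕ × ℕ × β => (p x.2.2).getD x.1 0 :=
    (list_getD 0).comp (hp1.comp snd) fst
  have hi : Primrec fun x : ℕ × ℕ × β => x.2.1 := fst.comp snd
  exact PrimrecPred.and
    (primrecPred_imp (Primrec.eq.comp hpi2 hpk2) (Primrec.eq.comp hi fst))
    (nat_le.comp (primrec_tableEntry hT2 hi hpk2)
      (nat_max.comp (primrec_tableEntry hT2 hi hpi2) (primrec_tableEntry hT2 fst hpk2)))

/-- The test is primitive recursive; the unbounded search for a code yields computability. -/
theorem computable_pivotColumns : Computable pivotColumns := by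
  have hdec : Primrec fun n : ℕ => (Encodable.decode n : Option (List ℕ)).getD [] :=
    option_getD.comp Primrec.decode (.const [])
  have hP : PrimrecPred fun x : List (List ℕ) × ℕ =>
      IsDominant x.1 ((Encodable.decode x.2).getD []) :=
    primrecPred_isDominant fst (hdec.comp snd)
  exact hdec.to_comp.comp (Computable.find hP.computablePred exists_code_isDominant)

variable {T : β → List (List ℕ)} {p : β → List ℕ}

theorem primrec_pivotDegree {i : β → ℕ} (hT : Primrec T) (hp : Primrec p) (hi : Primrec i) :
    Primrec fun b => pivotDegree (T b) (p b) (i b) :=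
  primrec_tableEntry hT hi ((list_getD 0).comp hp hi)

theorem primrec_digitLength (hT : Primrec T) (hp : Primrec p) :
    Primrec fun b => digitLength (T b) (p b) :=
  Primrec.succ.comp (nat_div.comp (nat_sub.comp (primrec_sum.comp
    (list_map (g := fun b i => pivotDegree (T b) (p b) i)
      (list_range.comp (list_length.comp hT))
      (primrec_pivotDegree (hT.comp fst) (hp.comp fst) snd))) (.const 1)) (list_length.comp hT))

theorem primrec_linLabels (hT : Primrec T) (hp : Primrec p) :
    Primrec fun b => linLabels (T b) (p b) := by
  have hr : Primrec fun b => List.range (T b).length := list_range.comp (list_length.comp hT)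
  have hcount : Primrec fun x : β × ℕ => List.range (extraCount (T x.1) (p x.1) x.2) :=
    list_range.comp (nat_div.comp (primrec_pivotDegree (hT.comp fst) (hp.comp fst) snd)
      (primrec_digitLength (hT.comp fst) (hp.comp fst)))
  have hextra (t : ℕ) : Primrec fun b => (List.range (T b).length).flatMap fun i =>
      (List.range (extraCount (T b) (p b) i)).map fun k => (t, i, k + 1) :=
    list_flatMap hr (list_map hcount
      (Primrec.pair (.const t) (Primrec.pair (snd.comp fst) (Primrec.succ.comp snd))))
  exact list_append.comp (list_map hr (Primrec.pair (.const 0) (Primrec.pair snd (.const 0))))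
    (list_append.comp (hextra 1) (hextra 2))

theorem primrec_operandCoeff {i j k : β → ℕ} (hi : Primrec i) (hj : Primrec j) (hk : Primrec k) :
    Primrec fun b => Operand.coeff (i b) (j b) (k b) :=
  (Primrec.of_equiv_symm (e := Operand.equiv)).comp
    (sumInl.comp (sumInr.comp (Primrec.pair hi (Primrec.pair hj hk))))

theorem primrec_digitOperand {e i j d k : β → ℕ} (he : Primrec e) (hi : Primrec i)
    (hj : Primrec j) (hd : Primrec d) (hk : Primrec k) :
    Primrec fun b => digitOperand (e b) (i b) (j b) (d b) (k b) :=
  Primrec.ite (nat_lt.comp hk he)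
    (primrec_operandCoeff hi hj (nat_add.comp (nat_mul.comp hd he) hk)) (.const _)

theorem primrec_linOperand {x y : β → ℕ × ℕ × ℕ} {k : β → ℕ} (hT : Primrec T) (hp : Primrec p)
    (hx : Primrec x) (hy : Primrec y) (hk : Primrec k) :
    Primrec fun b => linOperand (T b) (p b) (x b) (y b) (k b) := by
  have hx1 : Primrec fun b => (x b).1 := fst.comp hx
  have hx2 : Primrec fun b => (x b).2.1 := fst.comp (snd.comp hx)
  have hx3 : Primrec fun b => (x b).2.2 := snd.comp (snd.comp hx)
  have hy1 : Primrec fun b => (y b).1 := fst.comp hy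
  have hy2 : Primrec fun b => (y b).2.1 := fst.comp (snd.comp hy)
  have hy3 : Primrec fun b => (y b).2.2 := snd.comp (snd.comp hy)
  have hpx : Primrec fun b => (p b).getD (x b).2.1 0 := (list_getD 0).comp hp hx2
  have hpy : Primrec fun b => (p b).getD (y b).2.1 0 := (list_getD 0).comp hp hy2
  have he := primrec_digitLength hT hp
  have hpd := primrec_pivotDegree hT hp hx2
  have heq {f g : β → ℕ} (hf : Primrec f) (hg : Primrec g) : PrimrecPred fun b => f b = g b :=
    Primrec.eq.comp hf hg
  have hke := heq hk he
  have hk0 := heq hk (.const 0)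
  have h22 := heq hx2 hy2
  unfold linOperand
  refine Primrec.ite (heq hx1 (.const 2)) ?_ ?_
  · refine Primrec.ite (heq hy1 (.const 2)) ?_ ?_
    · exact Primrec.ite (h22.and ((heq hy3 hx3).and hk0)) (.const _)
        (Primrec.ite (h22.and ((heq hx3 (Primrec.succ.comp hy3)).and hke)) (.const _) (.const _))
    · exact Primrec.ite ((heq hy1 (.const 0)).and ((heq hy2 hpx).and
        ((heq hx3 (.const 1)).and hke))) (.const _) (.const _)
  · refine Primrec.ite (heq hy1 (.const 2)) ?_ (Primrec.ite (heq hy1 (.const 1)) ?_ ?_)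
    · exact Primrec.ite ((heq hx3 (.const 0)).and
        (nat_le.comp (primrec_tableEntry hT hx2 hpy) hpd).not)
        (primrec_digitOperand he hx2 hpy hy3 hk) (.const _)
    · exact Primrec.ite (h22.and ((heq hy3 hx3).and hk0)) (.const _)
        (Primrec.ite (h22.and ((heq hy3 (Primrec.succ.comp hx3)).and hke)) (.const _) (.const _))
    · exact Primrec.ite ((heq hx3 (.const 0)).or
        (nat_le.comp (primrec_tableEntry hT hx2 hy2) hpd))
        (primrec_digitOperand he hx2 hy2 hx3 hk) (.const _)

theorem primrec_largeShift {s : β → List ℤ} (hT : Primrec T) (hs : Primrec s) :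
    Primrec fun b => largeShift (T b) (s b) :=
  (Primrec.ofNat ℤ).comp (nat_mul.comp (.const 2) (nat_add.comp
    (primrec_sum.comp (list_map (g := fun _ => List.sum) hT (primrec_sum.comp snd)))
    (primrec_sum.comp (list_map (g := fun _ => Encodable.encode) hs (Primrec.encode.comp snd)))))

theorem primrec_linShift {s : β → List ℤ} {x : β → ℕ × ℕ × ℕ} (hT : Primrec T) (hs : Primrec s)
    (hx : Primrec x) : Primrec fun b => linShift (T b) (s b) (x b) :=
  Primrec.ite (Primrec.eq.comp (fst.comp hx) (.const 0))
    ((list_getD 0).comp hs (fst.comp (snd.comp hx))) (primrec_largeShift hT hs)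

theorem primrec_linConstruction {s : β → List ℤ} (hT : Primrec T) (hs : Primrec s)
    (hp : Primrec p) : Primrec fun b => linConstruction (T b) (s b) (p b) := by
  have hL := primrec_linLabels hT hp
  have hrange : Primrec fun b => List.range (digitLength (T b) (p b) + 1) :=
    list_range.comp (Primrec.succ.comp (primrec_digitLength hT hp))
  have hshift : Primrec fun b => (linLabels (T b) (p b)).map (linShift (T b) (s b)) :=
    list_map hL (primrec_linShift (hT.comp fst) (hs.comp fst) snd)
  have hentry : Primrec fun z : (β × ℕ × ℕ × ℕ) × ℕ × ℕ × ℕ =>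
      (List.range (digitLength (T z.1.1) (p z.1.1) + 1)).map
        (linOperand (T z.1.1) (p z.1.1) z.1.2 z.2) :=
    list_map (hrange.comp (fst.comp fst)) (primrec_linOperand
      (hT.comp (fst.comp (fst.comp fst))) (hp.comp (fst.comp (fst.comp fst)))
      (snd.comp (fst.comp fst)) (snd.comp fst) snd)
  have hentries : Primrec fun b => (linLabels (T b) (p b)).map fun x =>
      (linLabels (T b) (p b)).map fun y =>
        (List.range (digitLength (T b) (p b) + 1)).map (linOperand (T b) (p b) x y) :=
    list_map hL (list_map (hL.comp fst) hentry)
  exact (Primrec.of_equiv_symm (e := Construction.equiv)).comp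
    (Primrec.pair (.const []) (Primrec.pair (list_length.comp hL) (Primrec.pair hshift hentries)))

theorem computable_linPlan : Computable linPlan := by
  have h : Primrec fun x : (List (List ℕ) × List ℤ) × List ℕ => linConstruction x.1.1 x.1.2 x.2 :=
    primrec_linConstruction (fst.comp fst) (snd.comp fst) snd
  have h2 : Computable fun a : List (List ℕ) × List ℤ => (a, pivotColumns a.1) :=
    Computable.pair Computable.id (computable_pivotColumns.comp Computable.fst)
  have h3 := h.to_comp.comp h2
  exact h3

end Computability

end PolyMat

namespace PolyMat

/-! ### The operands evaluate to the entries of the partial linearization. -/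

section Correctness

variable {K : Type*} [Field K] {m : ℕ}

/-- The entries of a matrix, as a function of natural numbers which is zero out of range. -/
noncomputable def entryNat (A : Matrix (Fin m) (Fin m) K[X]) (i j : ℕ) : K[X] :=
  if h : i < m ∧ j < m then A ⟨i, h.1⟩ ⟨j, h.2⟩ else 0

theorem value_coeff (A : Matrix (Fin m) (Fin m) K[X]) (r : List K) (i j k : ℕ) :
    (Operand.coeff i j k).value A r = (entryNat A i j).coeff k := by
  unfold entryNat
  by_cases h : i < m ∧ j < m
  · rw [dif_pos h]; exact dif_pos h
  · rw [dif_neg h]; exact dif_neg h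

theorem value_zero (A : Matrix (Fin m) (Fin m) K[X]) (r : List K) : Operand.zero.value A r = 0 :=
  rfl

theorem value_one (A : Matrix (Fin m) (Fin m) K[X]) (r : List K) : Operand.one.value A r = 1 :=
  rfl

theorem value_negOne (A : Matrix (Fin m) (Fin m) K[X]) (r : List K) :
    Operand.negOne.value A r = -1 := rfl

theorem tableEntry_degreeTable (A : Matrix (Fin m) (Fin m) K[X]) (i j : ℕ) :
    tableEntry (degreeTable A) i j = (entryNat A i j).natDegree := by
  unfold tableEntry degreeTable entryNat
  by_cases hi : i < m
  · by_cases hj : j < m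
    · simp [List.getD_eq_getElem?_getD, hi, hj]
    · simp [List.getD_eq_getElem?_getD, hi, hj]
  · simp [List.getD_eq_getElem?_getD, hi]

theorem length_degreeTable (A : Matrix (Fin m) (Fin m) K[X]) : (degreeTable A).length = m := by
  simp [degreeTable]

theorem ofCoeffs_map_range (f : ℕ → K) (n : ℕ) :
    ofCoeffs ((List.range n).map f) = ∑ k ∈ Finset.range n, C (f k) * X ^ k := by
  unfold ofCoeffs
  rw [List.length_map, List.length_range]
  refine Finset.sum_congr rfl fun k hk => ?_
  rw [List.getD_eq_getElem?_getD]
  simp [Finset.mem_range.1 hk]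

/-- Every entry has `e + 1` coefficient slots, to make room for `X ^ e`; a digit leaves the last one
zero. -/
theorem sum_digitOperand (A : Matrix (Fin m) (Fin m) K[X]) (e i j d : ℕ) :
    ∑ k ∈ Finset.range (e + 1), C ((digitOperand e i j d k).value A []) * X ^ k =
      digit e d (entryNat A i j) := by
  rw [Finset.sum_range_succ, digitOperand, if_neg (lt_irrefl e)]
  simp only [value_zero, map_zero, zero_mul, add_zero]
  refine Finset.sum_congr rfl fun k hk => ?_
  rw [digitOperand, if_pos (Finset.mem_range.1 hk), value_coeff]

theorem sum_linOperand (A : Matrix (Fin m) (Fin m) K[X]) (T : List (List ℕ)) (p : List ℕ)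
    (x y : ℕ × ℕ × ℕ) :
    ∑ k ∈ Finset.range (digitLength T p + 1), C ((linOperand T p x y k).value A []) * X ^ k =
      linEntry (digitLength T p) (entryNat A)
        (fun i j => tableEntry T i j ≤ pivotDegree T p i) (fun k => p.getD k 0) x y := by
  have he : digitLength T p ≠ 0 := Nat.succ_ne_zero _
  set e := digitLength T p with hedef
  -- Nested conditions on operands become a sum of two terms because `P` and `Q` exclude each other.
  have hsingle (P Q : Prop) [Decidable P] [Decidable Q] (hPQ : ¬ (P ∧ Q)) (u v : Operand) :
      ∑ k ∈ Finset.range (e + 1), C ((if P ∧ k = 0 then u else if Q ∧ k = e then v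
        else Operand.zero).value A []) * X ^ k =
      (if P then C (u.value A []) else 0) + (if Q then C (v.value A []) * X ^ e else 0) := by
    by_cases hP : P
    · have hQ : ¬ Q := fun hQ => hPQ ⟨hP, hQ⟩
      rw [Finset.sum_eq_single 0]
      · simp [hP, hQ]
      · intro k _ hk; simp [hQ, hk, value_zero]
      · simp
    · by_cases hQ : Q
      · rw [Finset.sum_eq_single e]
        · simp [hP, hQ]
        · intro k _ hk; simp [hP, hk, value_zero]
        · simp
      · simp [hP, hQ, value_zero]
  unfold linOperand linEntry
  simp only [← and_assoc, ← hedef]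
  by_cases hx : x.1 = 2
  · simp only [if_pos hx]
    by_cases hy : y.1 = 2
    · simp only [if_pos hy]
      rw [hsingle _ _ (by omega), value_one, value_negOne]
      split_ifs <;> simp [sub_eq_add_neg, add_comm]
    · simp only [if_neg hy]
      have := hsingle False (y.1 = 0 ∧ y.2.1 = p.getD x.2.1 0 ∧ x.2.2 = 1) (by simp) .one .negOne
      simp only [false_and, if_false, zero_add, ← and_assoc] at this
      rw [this, value_negOne]
      split_ifs <;> simp
  · simp only [if_neg hx]
    by_cases hy : y.1 = 2
    · simp only [if_pos hy]
      by_cases h : x.2.2 = 0 ∧ ¬ tableEntry T x.2.1 (p.getD y.2.1 0) ≤ pivotDegree T p x.2.1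
      · simp only [if_pos h]
        exact sum_digitOperand A _ _ _ _
      · simp only [if_neg h, value_zero, map_zero, zero_mul, Finset.sum_const_zero]
    · simp only [if_neg hy]
      by_cases hy1 : y.1 = 1
      · simp only [if_pos hy1]
        rw [hsingle _ _ (by omega), value_one, value_negOne]
        split_ifs <;> simp [sub_eq_add_neg, add_comm]
      · simp only [if_neg hy1]
        by_cases h : x.2.2 = 0 ∨ tableEntry T x.2.1 y.2.1 ≤ pivotDegree T p x.2.1
        · simp only [if_pos h]
          exact sum_digitOperand A _ _ _ _
        · simp only [if_neg h, value_zero, map_zero, zero_mul, Finset.sum_const_zero]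

end Correctness

end PolyMat

namespace PolyMat

/-! ### Bounds on the dimension and the degree. -/

section Bounds

variable {T : List (List ℕ)} {p : List ℕ}

theorem pivotDegreeSum_eq (T : List (List ℕ)) (p : List ℕ) :
    pivotDegreeSum T p = ∑ i ∈ Finset.range T.length, pivotDegree T p i := rfl

/-- The digit length is the rounded-up mean pivot degree, with value `1` when the sum is zero, so
that the base is never `X ^ 0`. -/
theorem pivotDegreeSum_le_mul (hT : 0 < T.length) :
    pivotDegreeSum T p ≤ T.length * digitLength T p := by
  unfold digitLength
  have := Nat.lt_mul_div_succ (pivotDegreeSum T p - 1) hT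
  omega

theorem sum_extraCount_le (hT : 0 < T.length) :
    ∑ i ∈ Finset.range T.length, extraCount T p i ≤ T.length := by
  have he : 0 < digitLength T p := Nat.succ_pos _
  refine Nat.le_of_mul_le_mul_right (le_trans ?_ (pivotDegreeSum_le_mul hT)) he
  rw [Finset.sum_mul, pivotDegreeSum_eq]
  exact Finset.sum_le_sum fun i _ => Nat.div_mul_le_self _ _

theorem lt_extraCount_mul (T : List (List ℕ)) (p : List ℕ) (i : ℕ) :
    pivotDegree T p i < (extraCount T p i + 1) * digitLength T p := by
  have := Nat.lt_mul_div_succ (pivotDegree T p i) (Nat.succ_pos _ : 0 < digitLength T p)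
  rwa [mul_comm] at this

/-- With all pivot degrees zero there are no extra rows, hence no entry `X ^ e`; the degree bound
needs this case apart. -/
theorem pivotDegreeSum_pos {i : ℕ} (hi : i < T.length) (h : 0 < extraCount T p i) :
    0 < pivotDegreeSum T p := by
  have h1 : pivotDegree T p i ≤ pivotDegreeSum T p := by
    rw [pivotDegreeSum_eq]
    exact Finset.single_le_sum (f := pivotDegree T p) (fun _ _ => Nat.zero_le _)
      (Finset.mem_range.2 hi)
  have h2 := Nat.pos_of_div_pos h
  omega

theorem IsDominant.exists_eq (h : IsDominant T p) :
    ∃ π : Equiv.Perm (Fin T.length), ∀ i : Fin T.length, p.getD i 0 = π i := by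
  have hinj : Function.Injective fun i : Fin T.length =>
      (⟨p.getD i 0, (h i i.2).1⟩ : Fin T.length) := fun i k hik =>
    Fin.ext (((h i i.2).2 k k.2).1 (congrArg Fin.val hik))
  exact ⟨Equiv.ofBijective _ (Finite.injective_iff_bijective.1 hinj), fun i => rfl⟩

theorem natDegree_linEntry_lt {K : Type*} [Field K] {e : ℕ} (he : 0 < e) {a : ℕ → ℕ → K[X]}
    {rt : ℕ → ℕ → Prop} [∀ i j, Decidable (rt i j)] {p : ℕ → ℕ} {x y : ℕ × ℕ × ℕ} (hx : x.1 = 0)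
    (hy : y.1 = 0) : (linEntry e a rt p x y).natDegree < e := by
  unfold linEntry
  simp only [hx, hy, OfNat.zero_ne_ofNat, zero_ne_one, if_false]
  split_ifs
  · exact natDegree_digit_lt he _ _
  · simpa using he

theorem natDegree_linEntry_le {K : Type*} [Field K] {e : ℕ} (he : 0 < e) (a : ℕ → ℕ → K[X])
    (rt : ℕ → ℕ → Prop) [∀ i j, Decidable (rt i j)] (p : ℕ → ℕ) (x y : ℕ × ℕ × ℕ) :
    (linEntry e a rt p x y).natDegree ≤ e := by
  have h1 (P Q : Prop) [Decidable P] [Decidable Q] :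
      ((if P then (1 : K[X]) else 0) - (if Q then X ^ e else 0)).natDegree ≤ e := by
    refine (natDegree_sub_le _ _).trans (max_le ?_ ?_) <;> split_ifs <;> simp
  have h2 (P Q : Prop) [Decidable P] [Decidable Q] :
      ((if P then (X : K[X]) ^ e else 0) - (if Q then 1 else 0)).natDegree ≤ e := by
    refine (natDegree_sub_le _ _).trans (max_le ?_ ?_) <;> split_ifs <;> simp
  unfold linEntry
  by_cases hx : x.1 = 2
  · simp only [if_pos hx]
    by_cases hy : y.1 = 2
    · simp only [if_pos hy]; exact h1 _ _
    · simp only [if_neg hy]; split_ifs <;> simp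
  · simp only [if_neg hx]
    by_cases hy : y.1 = 2
    · simp only [if_pos hy]
      split_ifs
      · exact (natDegree_digit_lt he _ _).le
      · simp
    · simp only [if_neg hy]
      by_cases hy1 : y.1 = 1
      · simp only [if_pos hy1]; exact h2 _ _
      · simp only [if_neg hy1]
        split_ifs
        · exact (natDegree_digit_lt he _ _).le
        · simp

end Bounds

/-! ### Assembly. -/

section Main

variable {K : Type*} [Field K] {T : List (List ℕ)} {p : List ℕ}

theorem matrix_linConstruction {m : ℕ} (A : Matrix (Fin m) (Fin m) K[X]) (s : List ℤ) :
    (linConstruction T s p).matrix A =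
      linMatrix T.length (digitLength T p) (extraCount T p) (entryNat A)
        (fun i j => tableEntry T i j ≤ pivotDegree T p i) (fun k => p.getD k 0) := by
  funext x y
  have hx : (x : ℕ) < (linLabels T p).length := x.2
  have hy : (y : ℕ) < (linLabels T p).length := y.2
  refine Eq.trans ?_ (sum_linOperand A T p _ _)
  rw [← ofCoeffs_map_range]
  change ofCoeffs ((((((linLabels T p).map fun x => (linLabels T p).map fun y =>
    (List.range (digitLength T p + 1)).map (linOperand T p x y)).getD x []).getD y []).map
    (Operand.value A []))) = _
  simp only [List.getD_eq_getElem?_getD, List.getElem?_map, List.getElem?_eq_getElem hx,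
    List.getElem?_eq_getElem hy, Option.map_some, Option.getD_some, List.map_map]
  rfl

theorem shiftFun_linConstruction (s : List ℤ) (x : Fin (linConstruction T s p).dim) :
    (linConstruction T s p).shiftFun x =
      linShift T s ((labels T.length (extraCount T p)).get x) := by
  have hx : (x : ℕ) < (linLabels T p).length := x.2
  change ((linLabels T p).map (linShift T s)).getD x 0 = _
  simp only [List.getD_eq_getElem?_getD, List.getElem?_map, List.getElem?_eq_getElem hx,
    Option.map_some, Option.getD_some]
  rfl

/-- Each factor of a Leibniz term is bounded by the sum of its row of the table. The bound is crude,
but any one computable from degrees will do for the shift. -/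
theorem natDegree_det_le_sum {A : Matrix (Fin T.length) (Fin T.length) K[X]}
    (hT : ∀ i j, tableEntry T i j = (entryNat A i j).natDegree) :
    A.det.natDegree ≤ (T.map List.sum).sum := by
  have hrow (i : Fin T.length) (j : ℕ) : tableEntry T i j ≤ T[i].sum := by
    unfold tableEntry
    simp only [List.getD_eq_getElem?_getD, List.getElem?_eq_getElem i.2, Option.getD_some]
    by_cases hj : j < (T[(i : ℕ)]).length
    · rw [List.getElem?_eq_getElem hj]
      exact List.le_sum_of_mem (List.getElem_mem hj)
    · simp [List.getElem?_eq_none (not_lt.1 hj)]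
  have hsum : (T.map List.sum).sum = ∑ i : Fin T.length, T[i].sum := by
    rw [← List.sum_ofFn]
    congr 1
    exact (List.ofFn_getElem_eq_map T List.sum).symm
  rw [Matrix.det_apply, hsum]
  refine natDegree_sum_le_of_forall_le _ _ fun π _ => ?_
  have h1 : (Equiv.Perm.sign π • ∏ i, A (π i) i).natDegree ≤ (∏ i, A (π i) i).natDegree := by
    rcases Int.units_eq_one_or (Equiv.Perm.sign π) with h | h <;> simp [h]
  refine h1.trans ((natDegree_prod_le _ _).trans ?_)
  rw [← Equiv.sum_comp π fun i => T[i].sum]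
  refine Finset.sum_le_sum fun i _ => ?_
  have := hrow (π i) i
  rw [hT] at this
  simpa [entryNat] using this

theorem linConstruction_spec {A : Matrix (Fin T.length) (Fin T.length) K[X]}
    (hT0 : 0 < T.length) (hT : ∀ i j, tableEntry T i j = (entryNat A i j).natDegree)
    (s : Fin T.length → ℤ) (hA : A.det ≠ 0) (hp : IsDominant T p) {c : Construction}
    (hc : c = linConstruction T (List.ofFn s) p) :
    c.fieldOpCount = 0 ∧ (c.matrix A).det ≠ 0 ∧ c.dim ≤ 3 * T.length ∧
      matDegree (c.matrix A) ≤ ⌈(genericDetBound A : ℚ) / (T.length : ℚ)⌉₊ ∧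
      ∃ (hm : T.length ≤ c.dim) (P : Matrix (Fin c.dim) (Fin c.dim) K[X]),
        (∀ Q, IsPopovFormOf c.shiftFun (c.matrix A) Q ↔ Q = P) ∧
        (∀ Q, IsPopovFormOf s A Q ↔ Q = P.submatrix (Fin.castLE hm) (Fin.castLE hm)) := by
  subst hc
  have hentry (i j : Fin T.length) : entryNat A i j = A i j := by simp [entryNat]
  obtain ⟨π, hπ⟩ := hp.exists_eq
  have he : 0 < digitLength T p := Nat.succ_pos _
  have hm : T.length ≤ (linConstruction T (List.ofFn s) p).dim := le_length_labels
  have hmat := matrix_linConstruction (T := T) (p := p) A (List.ofFn s)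
  have hcol : ∀ j < T.length, ∃ k < T.length, ∀ k' < T.length,
      p.getD k' 0 = j ↔ k' = k := by
    intro j hj
    refine ⟨π.symm ⟨j, hj⟩, Fin.is_lt _, fun k' hk' => ?_⟩
    have h1 := hπ ⟨k', hk'⟩
    simp only at h1
    rw [h1]
    constructor
    · intro h
      have : (⟨j, hj⟩ : Fin T.length) = π ⟨k', hk'⟩ := Fin.ext h.symm
      rw [this, Equiv.symm_apply_apply]
    · intro h
      have : (⟨k', hk'⟩ : Fin T.length) = π.symm ⟨j, hj⟩ := Fin.ext h
      rw [this, Equiv.apply_symm_apply]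
  have hrs : rowSpace ((linConstruction T (List.ofFn s) p).matrix A) =
      (rowSpace A).comap (collapseₗ T.length (digitLength T p)
      (extraCount T p) (entryNat A) (fun i j => tableEntry T i j ≤ pivotDegree T p i)
      (fun k => p.getD k 0)) := by
    refine (congrArg rowSpace hmat).trans (rowSpace_linMatrix hentry ?_ ?_
      (fun k hk => (hp k hk).1) hcol)
    · intro i _ j _ h
      rw [← hT]
      exact h.trans_lt (lt_extraCount_mul T p i)
    · intro i hi k hk h
      rw [← hT]
      -- Dominance: an entry above its row pivot is at most its column pivot.
      have := ((hp i hi).2 k hk).2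
      rcases le_max_iff.1 this with h' | h'
      · exact absurd h' h
      · exact h'.trans_lt (lt_extraCount_mul T p k)
  have hshift := shiftFun_linConstruction (T := T) (p := p) (List.ofFn s)
  obtain ⟨hdet, hpopov⟩ := exists_popov_of_rowSpace_eq_comap hm (s := s) hA
    (u := (linConstruction T (List.ofFn s) p).shiftFun)
    (fun i => by
      refine (hshift _).trans ?_
      have := labels_get_of_lt (m := T.length) (α := extraCount T p)
        (x := Fin.castLE hm i) i.2
      refine (congrArg _ this).trans ?_
      change (List.ofFn s).getD i 0 = s i
      simp [List.getD_eq_getElem?_getD])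
    (fun x hx k => by
      have h1 : ((labels T.length (extraCount T p)).get x).1 ≠ 0 := by
        rcases labels_get_of_le (m := T.length) (α := extraCount T p) hx with
          ⟨i, -, l, -, h⟩ | ⟨i, -, l, -, h⟩ <;> rw [h] <;> simp
      refine le_of_le_of_eq ?_ (hshift _).symm
      rw [linShift, if_neg h1, natCast_le_largeShift]
      have h2 := natDegree_det_le_sum hT
      have h3 := le_encode_int (s k)
      have h4 : Encodable.encode (s k) ≤ ((List.ofFn s).map Encodable.encode).sum :=
        List.le_sum_of_mem (List.mem_map_of_mem (by simp))
      rw [Nat.cast_add]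
      omega)
    _ collapseₗ_extendZero hrs
  refine ⟨rfl, hdet, ?_, ?_, hm, hpopov⟩
  · have h1 : (linConstruction T (List.ofFn s) p).dim = _ :=
      length_labels (m := T.length) (α := extraCount T p)
    have h2 := sum_extraCount_le (p := p) hT0
    rw [h1]; omega
  · have hG : pivotDegreeSum T p ≤ genericDetBound A := by
      refine le_trans (le_of_eq ?_) (Finset.le_sup
        (f := fun π : Equiv.Perm (Fin T.length) => ∑ i, (A i (π i)).natDegree)
        (Finset.mem_univ π))
      rw [pivotDegreeSum_eq, Finset.sum_range]
      refine Finset.sum_congr rfl fun i _ => ?_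
      rw [pivotDegree, hπ, hT, hentry]
    have hceil (n : ℕ) (hn : n * T.length < genericDetBound A) :
        n < ⌈(genericDetBound A : ℚ) / (T.length : ℚ)⌉₊ := by
      rw [Nat.lt_ceil, lt_div_iff₀ (by exact_mod_cast hT0)]
      exact_mod_cast hn
    refine Finset.sup_le fun xy _ => ?_
    refine le_of_eq_of_le (congrArg natDegree (congrFun (congrFun hmat xy.1) xy.2)) ?_
    change (linEntry _ _ _ _ _ _).natDegree ≤ _
    -- Here the ceiling may be `0` while the digit length is `1`; the matrix then consists of digits
    -- only, of degree `< 1`.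
    by_cases h0 : pivotDegreeSum T p = 0
    · have hzero (x : Fin (linConstruction T (List.ofFn s) p).dim) :
          ((labels T.length (extraCount T p)).get x).1 = 0 := by
        by_cases hx : (x : ℕ) < T.length
        · rw [labels_get_of_lt (m := T.length) (α := extraCount T p) (x := x) hx]
        · rcases labels_get_of_le (m := T.length) (α := extraCount T p) (x := x) (not_lt.1 hx) with
            ⟨i, hi, l, hl, -⟩ | ⟨i, hi, l, hl, -⟩ <;>
          exact absurd h0 (pivotDegreeSum_pos hi (Nat.zero_lt_of_lt hl)).ne'
      have h1 : digitLength T p = 1 := by simp [digitLength, h0]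
      have := natDegree_linEntry_lt (a := entryNat A)
        (rt := fun i j => tableEntry T i j ≤ pivotDegree T p i) (p := fun k => p.getD k 0)
        he (hzero xy.1) (hzero xy.2)
      omega
    -- The digit length is `n + 1` with `n = (D - 1) / m`, and `n * m ≤ D - 1 < D ≤ σ(A)`.
    · refine (natDegree_linEntry_le he _ _ _ _ _).trans (hceil _ ?_)
      have := Nat.div_mul_le_self (pivotDegreeSum T p - 1) T.length
      omega

end Main

end PolyMat

open PolyMat
theorem proposition3p2 :
    ∃ plan : List (List ℕ) × List ℤ → Construction, Computable plan ∧
      ∀ (K : Type*) [Field K] (m : ℕ), 0 < m →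
      ∀ (A : Matrix (Fin m) (Fin m) K[X]) (s : Fin m → ℤ), A.det ≠ 0 →
      ∃ c : Construction, c = plan (degreeTable A, List.ofFn s) ∧
        c.fieldOpCount = 0 ∧
        (c.matrix A).det ≠ 0 ∧
        c.dim ≤ 3 * m ∧
        matDegree (c.matrix A) ≤ ⌈(genericDetBound A : ℚ) / (m : ℚ)⌉₊ ∧
        ∃ (hm : m ≤ c.dim) (P : Matrix (Fin c.dim) (Fin c.dim) K[X]),
          (∀ Q, IsPopovFormOf c.shiftFun (c.matrix A) Q ↔ Q = P) ∧
          (∀ Q, IsPopovFormOf s A Q ↔ Q = P.submatrix (Fin.castLE hm) (Fin.castLE hm)) := by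
  refine ⟨linPlan, computable_linPlan, fun K _ m hm A s hA => ⟨_, rfl, ?_⟩⟩
  have hT := tableEntry_degreeTable A
  have hlen := length_degreeTable A
  have hp := isDominant_pivotColumns (degreeTable A)
  unfold linPlan
  dsimp only
  -- Forgetting where `p` and the table come from allows `m` to be replaced by the length of the
  -- table, which sizes the construction.
  generalize pivotColumns (degreeTable A) = p at hp ⊢
  generalize degreeTable A = T at hT hlen hp ⊢
  subst hlen
  exact linConstruction_spec hm hT s hA hp rfl
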